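/- Work over $\mathbb{C}$. Consider variables $p_1,p_2,p_3,p_4,u,v,t_1,t_2,L_{123},L_{124},L_{125},L_{126},L_{135},L_{136},L_{245},L_{246},s_1,s_2,s_3$. For $1\le i<j<k\le 6$ let $D_{ijk}$ be the $3\times 3$ minor with columns $i,j,k$ of $$M=\begin{pmatrix} u & v & -t_2p_2 & -t_2p_4 & -t_2p_1+t_1u & -t_2p_3+t_1v\\ -p_1 & -p_3 & u+t_1p_2 & v+t_1p_4 & -t_2p_2 & -t_2p_4\\ -p_2 & -p_4 & -p_1 & -p_3 & u & v\end{pmatrix},$$ let $$G=L_{123}D_{123}+L_{124}D_{124}+L_{125}D_{125}+L_{126}D_{126}+L_{135}D_{135}+L_{136}(D_{136}+2D_{145})+L_{245}(D_{245}+2D_{146})+L_{246}D_{246},$$ and let $$\begin{aligned} F_{1} &= (u s_{1} - p_{1} s_{2} - p_{2} s_{3}) - L_{126} (-p_{2} p_{3} + p_{1} p_{4}) - L_{136} (p_{1}^{2} + t_{1} p_{2}^{2} + p_{2} u) - L_{245} (2 p_{1} p_{3} + 2 t_{1} p_{2} p_{4} + p_{4} u + p_{2} v) - L_{246} (p_{3}^{2}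 + t_{1} p_{4}^{2} + p_{4} v) \\ F_{2} &= (v s_{1} - p_{3} s_{2} - p_{4} s_{3}) + L_{125} (-p_{2} p_{3} + p_{1} p_{4}) + L_{135} (p_{1}^{2} + t_{1} p_{2}^{2} + p_{2} u) + L_{136} (2 p_{1} p_{3} + 2 t_{1} p_{2} p_{4} + p_{4} u + p_{2} v) + L_{245} (p_{3}^{2} + t_{1} p_{4}^{2} + p_{4} v) \\ F_{3} &= (-t_{2} p_{2} s_{1} + (u + t_{1} p_{2}) s_{2} - p_{1} s_{3}) - L_{124} (-p_{2} p_{3} + p_{1} p_{4}) - L_{136} (t_{2} p_{2}^{2} + p_{1} u) - L_{245} (2 t_{2} p_{2} p_{4} + p_{3} u + p_{1} v) - L_{246} (t_{2} p_{4}^{2} + p_{3} v) \\ F_{4} &= (-t_{2} p_{4} s_{1} + (v + t_{1} p_{4}) s_{2} - p_{3} s_{3}) + L_{123} (-p_{2} p_{3} + p_{1} p_{4}) + L_{135} (t_{2} p_{2}^{2} + p_{1} u) + L_{136} (2 t_{2} p_{2} p_{4} + p_{3} u + p_{1} v) + L_{245} (t_{2} p_{4}^{2} + p_{3} v) \\ F_{5}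 &= (-t_{2} p_{1} s_{1} + (t_{1} p_{1} - t_{2} p_{2}) s_{2} + (u + t_{1} p_{2}) s_{3}) + L_{123} (p_{1}^{2} + t_{1} p_{2}^{2} + p_{2} u) + L_{124} (p_{1} p_{3} + t_{1} p_{2} p_{4} + p_{2} v) - L_{125} (t_{2} p_{2}^{2} + p_{1} u) - L_{126} (t_{2} p_{2} p_{4} + p_{1} v) - L_{136} (t_{1} p_{2} u - t_{2} p_{1} p_{2} + u^{2}) - L_{245} (t_{1} (p_{4} u + p_{2} v) - t_{2} (p_{2} p_{3} + p_{1} p_{4}) + 2 u v) - L_{246} (t_{1} p_{4} v - t_{2} p_{3} p_{4} + v^{2}) \\ F_{6} &= (-t_{2} p_{3} s_{1} + (t_{1} p_{3} - t_{2} p_{4}) s_{2} + (v + t_{1} p_{4}) s_{3}) + L_{123} (t_{1} p_{2} p_{4} + p_{1} p_{3} + p_{4} u) + L_{124} (p_{3}^{2} + t_{1} p_{4}^{2} + p_{4} v) - L_{125} (t_{2} p_{2} p_{4} + p_{3} u) - L_{126} (t_{2} p_{4}^{2} + p_{3} v) + L_{135} (t_{1} p_{2} u - t_{2} p_{1} p_{2}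 + u^{2}) + L_{136} (t_{1} (p_{4} u + p_{2} v) - t_{2} (p_{2} p_{3} + p_{1} p_{4}) + 2 u v) + L_{245} (t_{1} p_{4} v - t_{2} p_{3} p_{4} + v^{2}) \\ F_{7} &= (-s_{2}^{2} + s_{1} s_{3}) + ((L_{123} p_{2} + L_{124} p_{4}) s_{1} - (L_{125} p_{2} + L_{126} p_{4}) s_{2}) + L_{123} (L_{136} p_{2}^{2} + 2 L_{245} p_{2} p_{4} + L_{246} p_{4}^{2}) - L_{124} (L_{135} p_{2}^{2} + 2 L_{136} p_{2} p_{4} + L_{245} p_{4}^{2}) - L_{125} (L_{136} p_{1} p_{2} + L_{245} (p_{2} p_{3} + p_{1} p_{4}) + L_{246} p_{3} p_{4}) + L_{126} (L_{135} p_{1} p_{2} + L_{136} (p_{2} p_{3} + p_{1} p_{4}) + L_{245} p_{3} p_{4}) + (L_{135} L_{245} - L_{136}^{2}) (-p_{1}^{2} + 2 u p_{2} + t_{1} p_{2}^{2}) + (L_{135} L_{246} - L_{136} L_{245}) (-p_{1} p_{3} + u p_{4} + v p_{2} + t_{1} p_{2} p_{4}) + (L_{136} L_{246} - L_{245}^{2})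 (-p_{3}^{2} + 2 v p_{4} + t_{1} p_{4}^{2}) \\ F_{8} &= (s_{2} s_{3} + t_{1} s_{1} s_{2} - t_{2} s_{1}^{2}) + s_{1} (L_{123} p_{1} + L_{124} p_{3}) - s_{2} (L_{125} p_{1} + L_{126} p_{3}) + L_{123} (L_{136} p_{1} p_{2} + L_{245} (p_{1} p_{4} + p_{3} p_{2}) + L_{246} p_{3} p_{4}) - L_{124} (L_{135} p_{1} p_{2} + L_{136} (p_{1} p_{4} + p_{3} p_{2}) + L_{245} p_{3} p_{4}) - L_{125} (L_{136} p_{1}^{2} + 2 L_{245} p_{1} p_{3} + L_{246} p_{3}^{2}) + L_{126} (L_{135} p_{1}^{2} + 2 L_{136} p_{1} p_{3} + L_{245} p_{3}^{2}) + (-L_{136}^{2} + L_{135} L_{245}) (2 u p_{1} + 2 t_{1} p_{1} p_{2} - t_{2} p_{2}^{2}) + (L_{135} L_{246} - L_{136} L_{245}) ((v p_{1} + u p_{3}) + t_{1} (p_{1} p_{4} + p_{3} p_{2}) - t_{2} p_{2} p_{4}) + (L_{246} L_{136} - L_{245}^{2}) (2 v p_{3} + 2 t_{1} p_{3} p_{4}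 - t_{2} p_{4}^{2}) \\ F_{9} &= (t_{1} s_{2}^{2} + s_{3}^{2} - s_{1} s_{2} t_{2}) + s_{1} (L_{123} u + L_{124} v) - s_{2} (L_{125} u + L_{126} v) + (L_{124} L_{125} - L_{123} L_{126}) (-p_{2} p_{3} + p_{1} p_{4}) - L_{123} (L_{246} (p_{3}^{2} + t_{1} p_{4}^{2}) + L_{136} (p_{1}^{2} + t_{1} p_{2}^{2}) + 2 L_{245} (p_{1} p_{3} + t_{1} p_{2} p_{4})) + L_{124} (L_{135} (p_{1}^{2} + t_{1} p_{2}^{2}) + 2 L_{136} (p_{1} p_{3} + t_{1} p_{2} p_{4}) + L_{245} (p_{3}^{2} + t_{1} p_{4}^{2})) + L_{125} t_{2} (L_{246} p_{4}^{2} + L_{136} p_{2}^{2} + 2 L_{245} p_{2} p_{4}) - L_{126} t_{2} (L_{135} p_{2}^{2} + 2 L_{136} p_{2} p_{4} + L_{245} p_{4}^{2}) + (-L_{136}^{2} + L_{135} L_{245}) (u^{2} + 2 t_{2} p_{1} p_{2}) + (L_{135} L_{246} - L_{136} L_{245}) (u v + t_{2} (p_{2} p_{3} + p_{1} p_{4}))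 + (L_{246} L_{136} - L_{245}^{2}) (v^{2} + 2 t_{2} p_{3} p_{4}) \end{aligned}$$ Set $L_{246}=1$, and let $\Pi_{\mathbb{A}}^{14}\subset\mathbb{A}^{18}$ be the affine scheme $\{F_1=\dots=F_9=0\}|_{L_{246}=1}$. Give the variables weights such that $F_1,\dots,F_9$ are homogeneous, all weights being positive integers except $w(L_{246})=0$; that is, for some integer $w(G)$, $$\begin{aligned} &w(p_1)=w(p_3)+w(u)-w(v),\quad w(p_2)=2w(p_3)+w(u)-2w(v),\quad w(p_4)=2w(p_3)-w(v),\\ &w(s_1)=w(G)-(w(u)+3w(v)-2w(p_3)),\quad w(s_2)=w(G)-(w(u)+2w(v)-w(p_3)),\quad w(s_3)=w(G)-(w(u)+w(v)),\\ &w(t_1)=2(w(v)-w(p_3)),\quad w(t_2)=3(w(v)-w(p_3)),\\ &w(L_{123})=w(G)-(2w(p_3)+2w(u)-w(v)),\quad w(L_{124})=w(G)-(2w(p_3)+w(u)),\\ &w(L_{125})=w(G)-(w(p_3)+2w(u)),\quad w(L_{126})=w(G)-(w(p_3)+w(u)+w(v)),\\ &w(L_{135})=w(G)-3w(u),\quad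 w(L_{136})=w(G)-(2w(u)+w(v)),\quad w(L_{245})=w(G)-(w(u)+2w(v)),\quad w(L_{246})=w(G)-3w(v)=0 . \end{aligned}$$ Let $\Pi_{\mathbb{P}}^{13}\subset\mathbb{P}^{17}$ be the corresponding weighted projectivization ($\operatorname{Proj}$ of the coordinate ring of $\Pi_{\mathbb{A}}^{14}$), and let $\Pi_{\mathbb{P}}^{14}\subset\mathbb{P}^{18}$ be the weighted cone over it with one coordinate of weight one added. Let $H$ be the weighted projective hypersurface $\{G=0\}|_{L_{246}=1}$ in the weighted projective space of the fifteen remaining coordinates $p_1,\dots,L_{245}$ in the case of $\Pi_{\mathbb{P}}^{13}$, and the weighted cone over it with one coordinate of weight one added in the case of $\Pi_{\mathbb{P}}^{14}$. Then, for $\Pi=\Pi_{\mathbb{P}}^{13}$ and for $\Pi=\Pi_{\mathbb{P}}^{14}$: (1) As a set, the intersection of $\Pi$ with $\mathbb{P}(s_1,s_2,s_3)$ (the locus where all coordinates other than $s_1,s_2,s_3$ vanish) consists of only the $s_1$-point. The intersection is nonreduced in the following sense: its preimage in the local index cover at the $s_1$-point, that is, the chart $\{s_1=1\}$ of the affine cone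 over the scheme-theoretic intersection, is not reduced. (2) The projection $\Pi\dashrightarrow H$ forgetting $s_1,s_2,s_3$ is well defined, it is a morphism on the complement of this intersection, and it is birational: it restricts to an isomorphism from a dense open subscheme of $\Pi$ onto a dense open subscheme of $H$. (3) The exceptional locus of the projection, that is, the set of points of $\Pi$ near which it is not an isomorphism onto an open subscheme of $H$ (including the points where it is not defined), is contained in the common zero set in $\Pi$ of all the minors $D_{ijk}$ $(1\le i<j<k\le 6)$. This common zero set is a proper closed subset of $\Pi$. -/

import Mathlib

open AlgebraicGeometry CategoryTheory HomogeneousLocalization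

namespace KeyVariety

noncomputable section ProjGeneral

universe u

variable {A B σ τ : Type u} [CommRing A] [SetLike σ A] [AddSubgroupClass σ A]
  [CommRing B] [SetLike τ B] [AddSubgroupClass τ B]
  {𝒜 : ℕ → σ} {ℬ : ℕ → τ} [GradedRing 𝒜] [GradedRing ℬ] (φ : 𝒜 →+*ᵍ ℬ)

/-- For `f` homogeneous of positive degree, the morphism `D₊(φ f) ⟶ D₊(f) ⊆ Proj 𝒜` given by the
ring homomorphism `A_{(f)} → B_{(φ f)}` induced by `φ`. -/
def projPiece {n : ℕ} (f : A) (hf : f ∈ 𝒜 n) (hn : 0 < n) :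
    (Proj.basicOpen ℬ (φ f)).toScheme ⟶ Proj 𝒜 :=
  Proj.basicOpenToSpec ℬ (φ f) ≫
    Spec.map (CommRingCat.ofHom (Away.map φ f : Away 𝒜 f →+* Away ℬ (φ f))) ≫
    Proj.awayι 𝒜 f hf hn

lemma away_comm {n m : ℕ} (f g : A) (hf : f ∈ 𝒜 n) (hg : g ∈ 𝒜 m) :
    (Away.map φ (f * g)).comp (awayMap 𝒜 hg (x := f * g) rfl) =
      (awayMap ℬ (x := φ (f * g)) (φ.2 hg) (map_mul φ f g)).comp (Away.map φ f) := by
  refine RingHom.ext fun x => ?_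
  obtain ⟨k, x, hx, rfl⟩ := Away.mk_surjective _ hf x
  simp only [RingHom.comp_apply]
  rw [awayMap_mk, Away.map_mk, Away.map_mk]
  have h := awayMap_mk (𝒜 := ℬ) (φ.2 hg) (x := φ (f * g)) (map_mul φ f g) k (φ.2 hf) (φ x) (φ.2 hx)
  refine Eq.trans ?_ h.symm
  congr 1
  simp

lemma piece_deg {n m : ℕ} (f : A) (hf : f ∈ 𝒜 n) (hn : 0 < n) (hf' : f ∈ 𝒜 m) (hm : 0 < m) :
    projPiece φ f hf hn = projPiece φ f hf' hm := by
  rfl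

lemma piece_restrict {n m : ℕ} (f g : A) (hf : f ∈ 𝒜 n) (hg : g ∈ 𝒜 m) (hn : 0 < n)
    (h : Proj.basicOpen ℬ (φ (f * g)) ≤ Proj.basicOpen ℬ (φ f)) :
    (Proj ℬ).homOfLE h ≫ projPiece φ f hf hn =
      projPiece φ (f * g) (SetLike.mul_mem_graded hf hg) (Nat.add_pos_left hn m) := by
  have h1 := Proj.basicOpenToSpec_SpecMap_awayMap ℬ (f := φ f) (φ.2 hg)
    (show φ (f * g) = _ from map_mul φ f g)
  have h2 := Proj.SpecMap_awayMap_awayι 𝒜 hf hn hg (x := f * g) rfl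
  rw [projPiece, projPiece, ← h2, ← Spec.map_comp_assoc, ← CommRingCat.ofHom_comp,
    away_comm φ f g hf hg, CommRingCat.ofHom_comp, Spec.map_comp_assoc]
  rw [reassoc_of% h1]

lemma piece_comm {n m : ℕ} (f g : A) (hf : f ∈ 𝒜 n) (hg : g ∈ 𝒜 m) (hn : 0 < n) (hm : 0 < m)
    {T : Scheme.{u}} (a : T ⟶ (Proj.basicOpen ℬ (φ f)).toScheme)
    (b : T ⟶ (Proj.basicOpen ℬ (φ g)).toScheme)
    (hab : a ≫ (Proj.basicOpen ℬ (φ f)).ι = b ≫ (Proj.basicOpen ℬ (φ g)).ι) :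
    a ≫ projPiece φ f hf hn = b ≫ projPiece φ g hg hm := by
  have le1 : Proj.basicOpen ℬ (φ (f * g)) ≤ Proj.basicOpen ℬ (φ f) :=
    Proj.basicOpen_mono _ _ _ ⟨φ g, map_mul φ f g⟩
  have le2 : Proj.basicOpen ℬ (φ (f * g)) ≤ Proj.basicOpen ℬ (φ g) :=
    Proj.basicOpen_mono _ _ _ ⟨φ f, (map_mul φ f g).trans (mul_comm _ _)⟩
  have hr : Set.range (a ≫ (Proj.basicOpen ℬ (φ f)).ι) ⊆
      Set.range (Proj.basicOpen ℬ (φ (f * g))).ι := by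
    rintro _ ⟨t, rfl⟩
    rw [Scheme.Opens.range_ι, map_mul φ f g, Proj.basicOpen_mul]
    refine ⟨?_, ?_⟩
    · exact (a t).2
    · rw [hab]; exact (b t).2
  let l := IsOpenImmersion.lift (Proj.basicOpen ℬ (φ (f * g))).ι _ hr
  have hl : l ≫ (Proj.basicOpen ℬ (φ (f * g))).ι = a ≫ (Proj.basicOpen ℬ (φ f)).ι :=
    IsOpenImmersion.lift_fac _ _ _
  have ha : a = l ≫ (Proj ℬ).homOfLE le1 := by
    rw [← cancel_mono (Proj.basicOpen ℬ (φ f)).ι, Category.assoc, Scheme.homOfLE_ι, hl]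
  have hb : b = l ≫ (Proj ℬ).homOfLE le2 := by
    rw [← cancel_mono (Proj.basicOpen ℬ (φ g)).ι, Category.assoc, Scheme.homOfLE_ι, hl, hab]
  have e1 := piece_restrict φ f g hf hg hn le1
  have e2 : (Proj ℬ).homOfLE le2 ≫ projPiece φ g hg hm =
      projPiece φ (f * g) (SetLike.mul_mem_graded hf hg) (Nat.add_pos_left hn m) := by
    have hgf : g * f = f * g := mul_comm _ _
    have aux : ∀ (x : A) (hx : x = g * f) (k : ℕ) (hk : x ∈ 𝒜 k) (hk0 : 0 < k)
        (h : Proj.basicOpen ℬ (φ x) ≤ Proj.basicOpen ℬ (φ g)),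
        (Proj ℬ).homOfLE h ≫ projPiece φ g hg hm = projPiece φ x hk hk0 := by
      rintro x rfl k hk hk0 h
      rw [piece_restrict φ g f hg hf hm h]
      exact piece_deg φ _ _ _ _ _
    exact aux _ hgf.symm _ _ _ _
  rw [ha, hb, Category.assoc, Category.assoc, e1, e2]

/-- Homogeneous elements of positive degree. -/
abbrev PosElem (𝒜 : ℕ → σ) : Type u := Σ n : {n : ℕ // 0 < n}, 𝒜 n.1

/-- The union of the `D₊(φ f)` for `f` homogeneous of positive degree, i.e. the complement in `Proj ℬ`
of the common zero set of the image of the irrelevant ideal of `𝒜`. -/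
def projDomain : (Proj ℬ).Opens := ⨆ f : PosElem 𝒜, Proj.basicOpen ℬ (φ f.2)

/-- The morphism to `Proj 𝒜` induced by `φ` on the open subset of `Proj ℬ` where it is defined, glued
from the morphisms `projPiece`. -/
def projection : (projDomain φ).toScheme ⟶ Proj 𝒜 :=
  (Scheme.Opens.iSupOpenCover fun f : PosElem 𝒜 => Proj.basicOpen ℬ (φ f.2)).glueMorphisms
    (fun f => projPiece φ (f.2 : A) f.2.2 f.1.2)
    fun f g => piece_comm φ _ _ f.2.2 g.2.2 f.1.2 g.1.2 _ _ (by
      have h := Limits.pullback.condition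
        (f := (Proj ℬ).homOfLE (le_iSup (fun f : PosElem 𝒜 => Proj.basicOpen ℬ (φ f.2)) f))
        (g := (Proj ℬ).homOfLE (le_iSup (fun f : PosElem 𝒜 => Proj.basicOpen ℬ (φ f.2)) g))
      have h' := congr($h ≫ Scheme.Opens.ι _)
      simp only [Category.assoc, Scheme.homOfLE_ι] at h'
      exact h')

/-- On `D₊(φ f)`, the morphism `projection φ` is `projPiece`. -/
lemma projection_restrict (f : PosElem 𝒜) :
    (Proj ℬ).homOfLE (le_iSup (fun f : PosElem 𝒜 => Proj.basicOpen ℬ (φ f.2)) f) ≫ projection φ =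
      projPiece φ (f.2 : A) f.2.2 f.1.2 :=
  (Scheme.Opens.iSupOpenCover fun f : PosElem 𝒜 => Proj.basicOpen ℬ (φ f.2)).ι_glueMorphisms _ _ f

end ProjGeneral

noncomputable section Quot
open DirectSum
variable {R A : Type*} [CommRing R] [CommRing A] [Algebra R A] (𝒜 : ℕ → Submodule R A)
  [GradedAlgebra 𝒜] (I : HomogeneousIdeal 𝒜)

/-- The grading of the quotient by a homogeneous ideal: the images of the graded pieces. -/
def quotGrading (n : ℕ) : Submodule R (A ⧸ I.toIdeal) :=
  (𝒜 n).map (Ideal.Quotient.mkₐ R I.toIdeal).toLinearMap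

lemma mk_mem_quotGrading {n : ℕ} {a : A} (h : a ∈ 𝒜 n) :
    Ideal.Quotient.mk I.toIdeal a ∈ quotGrading 𝒜 I n := ⟨a, h, rfl⟩

instance : SetLike.GradedMonoid (quotGrading 𝒜 I) where
  one_mem := ⟨1, SetLike.GradedOne.one_mem, rfl⟩
  mul_mem := by
    rintro i j _ _ ⟨a, ha, rfl⟩ ⟨b, hb, rfl⟩
    exact ⟨a * b, SetLike.mul_mem_graded ha hb, rfl⟩

def quotPart (n : ℕ) : 𝒜 n →+ quotGrading 𝒜 I n where
  toFun a := ⟨Ideal.Quotient.mk I.toIdeal a, mk_mem_quotGrading 𝒜 I a.2⟩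
  map_zero' := Subtype.ext (map_zero _)
  map_add' _ _ := Subtype.ext (map_add _ _ _)

def preDecompose : A →+ ⨁ n, quotGrading 𝒜 I n :=
  (DirectSum.map (quotPart 𝒜 I)).comp (decomposeAddEquiv 𝒜).toAddMonoidHom

lemma preDecompose_eq_zero {a : A} (ha : a ∈ I.toIdeal) : preDecompose 𝒜 I a = 0 := by
  refine DFinsupp.ext fun n => Subtype.ext ?_
  have h : (preDecompose 𝒜 I a) n = quotPart 𝒜 I n (decompose 𝒜 a n) := by
    simp [preDecompose, DirectSum.map_apply]
  rw [h]
  exact Ideal.Quotient.eq_zero_iff_mem.2 (I.isHomogeneous n ha)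

lemma preDecompose_coe {n : ℕ} (a : 𝒜 n) :
    preDecompose 𝒜 I a = DirectSum.of (fun n => quotGrading 𝒜 I n) n (quotPart 𝒜 I n a) := by
  simp [preDecompose, DirectSum.map_of]

def quotDecompose : A ⧸ I.toIdeal →+ ⨁ n, quotGrading 𝒜 I n :=
  QuotientAddGroup.lift I.toIdeal.toAddSubgroup (preDecompose 𝒜 I)
    fun _ ha => preDecompose_eq_zero 𝒜 I ha

instance : GradedAlgebra (quotGrading 𝒜 I) where
  toDecomposition := Decomposition.ofAddHom _ (quotDecompose 𝒜 I)
    (by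
      ext x
      obtain ⟨a, rfl⟩ := Ideal.Quotient.mk_surjective x
      change DirectSum.coeAddMonoidHom _ (preDecompose 𝒜 I a) = Ideal.Quotient.mk _ a
      induction a using DirectSum.Decomposition.inductionOn 𝒜 with
      | zero => simp
      | homogeneous a => rw [preDecompose_coe, coeAddMonoidHom_of]; rfl
      | add a b ha hb => rw [map_add, map_add, map_add, ha, hb])
    (by
      refine DirectSum.addHom_ext fun n y => ?_
      obtain ⟨_, a, ha, rfl⟩ := y
      change quotDecompose 𝒜 I (DirectSum.coeAddMonoidHom _ _) = _
      rw [coeAddMonoidHom_of]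
      exact preDecompose_coe 𝒜 I ⟨a, ha⟩)

end Quot
section Equations

/-- Values of the sixteen coordinates `p1, …, L246`. -/
structure BaseTuple (R : Type*) where
  (p1 p2 p3 p4 u v t1 t2 L123 L124 L125 L126 L135 L136 L245 L246 : R)

/-- Values of the nineteen coordinates `p1, …, L246, s1, s2, s3`. -/
structure PiTuple (R : Type*) extends BaseTuple R where
  (s1 s2 s3 : R)

variable {R : Type*} [CommRing R]

/-- The `3 × 6` matrix `M`. -/
def M (x : BaseTuple R) : Matrix (Fin 3) (Fin 6) R :=
  !![x.u, x.v, -x.t2 * x.p2, -x.t2 * x.p4, -x.t2 * x.p1 + x.t1 * x.u, -x.t2 * x.p3 + x.t1 * x.v;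
    -x.p1, -x.p3, x.u + x.t1 * x.p2, x.v + x.t1 * x.p4, -x.t2 * x.p2, -x.t2 * x.p4;
    -x.p2, -x.p4, -x.p1, -x.p3, x.u, x.v]

/-- The minor of `M` on the columns `i, j, k`, where the columns are numbered from `0` to `5`;
so `D x 0 1 2` is what is usually written `D_{123}`. -/
def D (x : BaseTuple R) (i j k : Fin 6) : R := ((M x).submatrix id ![i, j, k]).det

/-- The polynomial `G = L123 D123 + L124 D124 + L125 D125 + L126 D126 + L135 D135
+ L136 (D136 + 2 D145) + L245 (D245 + 2 D146) + L246 D246`. -/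
def G (x : BaseTuple R) : R :=
  x.L123 * D x 0 1 2 + x.L124 * D x 0 1 3 + x.L125 * D x 0 1 4 + x.L126 * D x 0 1 5
    + x.L135 * D x 0 2 4 + x.L136 * (D x 0 2 5 + 2 * D x 0 3 4)
    + x.L245 * (D x 1 3 4 + 2 * D x 0 3 5) + x.L246 * D x 1 3 5

/-- The equation `F1`. -/
def F1 (x : PiTuple R) : R :=
    (x.u * x.s1 - x.p1 * x.s2 - x.p2 * x.s3) - x.L126 * (-x.p2 * x.p3 + x.p1 * x.p4)
    - x.L136 * (x.p1 ^ 2 + x.t1 * x.p2 ^ 2 + x.p2 * x.u)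
    - x.L245 * (2 * x.p1 * x.p3 + 2 * x.t1 * x.p2 * x.p4 + x.p4 * x.u + x.p2 * x.v)
    - x.L246 * (x.p3 ^ 2 + x.t1 * x.p4 ^ 2 + x.p4 * x.v)

/-- The equation `F2`. -/
def F2 (x : PiTuple R) : R :=
    (x.v * x.s1 - x.p3 * x.s2 - x.p4 * x.s3) + x.L125 * (-x.p2 * x.p3 + x.p1 * x.p4)
    + x.L135 * (x.p1 ^ 2 + x.t1 * x.p2 ^ 2 + x.p2 * x.u)
    + x.L136 * (2 * x.p1 * x.p3 + 2 * x.t1 * x.p2 * x.p4 + x.p4 * x.u + x.p2 * x.v)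
    + x.L245 * (x.p3 ^ 2 + x.t1 * x.p4 ^ 2 + x.p4 * x.v)

/-- The equation `F3`. -/
def F3 (x : PiTuple R) : R :=
    (-x.t2 * x.p2 * x.s1 + (x.u + x.t1 * x.p2) * x.s2 - x.p1 * x.s3)
    - x.L124 * (-x.p2 * x.p3 + x.p1 * x.p4) - x.L136 * (x.t2 * x.p2 ^ 2 + x.p1 * x.u)
    - x.L245 * (2 * x.t2 * x.p2 * x.p4 + x.p3 * x.u + x.p1 * x.v)
    - x.L246 * (x.t2 * x.p4 ^ 2 + x.p3 * x.v)

/-- The equation `F4`. -/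
def F4 (x : PiTuple R) : R :=
    (-x.t2 * x.p4 * x.s1 + (x.v + x.t1 * x.p4) * x.s2 - x.p3 * x.s3)
    + x.L123 * (-x.p2 * x.p3 + x.p1 * x.p4) + x.L135 * (x.t2 * x.p2 ^ 2 + x.p1 * x.u)
    + x.L136 * (2 * x.t2 * x.p2 * x.p4 + x.p3 * x.u + x.p1 * x.v)
    + x.L245 * (x.t2 * x.p4 ^ 2 + x.p3 * x.v)

/-- The equation `F5`. -/
def F5 (x : PiTuple R) : R :=
    (-x.t2 * x.p1 * x.s1 + (x.t1 * x.p1 - x.t2 * x.p2) * x.s2 + (x.u + x.t1 * x.p2) * x.s3)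
    + x.L123 * (x.p1 ^ 2 + x.t1 * x.p2 ^ 2 + x.p2 * x.u)
    + x.L124 * (x.p1 * x.p3 + x.t1 * x.p2 * x.p4 + x.p2 * x.v)
    - x.L125 * (x.t2 * x.p2 ^ 2 + x.p1 * x.u) - x.L126 * (x.t2 * x.p2 * x.p4 + x.p1 * x.v)
    - x.L136 * (x.t1 * x.p2 * x.u - x.t2 * x.p1 * x.p2 + x.u ^ 2)
    - x.L245 * (x.t1 * (x.p4 * x.u + x.p2 * x.v) - x.t2 * (x.p2 * x.p3 + x.p1 * x.p4) + 2 * x.u * x.v)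
    - x.L246 * (x.t1 * x.p4 * x.v - x.t2 * x.p3 * x.p4 + x.v ^ 2)

/-- The equation `F6`. -/
def F6 (x : PiTuple R) : R :=
    (-x.t2 * x.p3 * x.s1 + (x.t1 * x.p3 - x.t2 * x.p4) * x.s2 + (x.v + x.t1 * x.p4) * x.s3)
    + x.L123 * (x.t1 * x.p2 * x.p4 + x.p1 * x.p3 + x.p4 * x.u)
    + x.L124 * (x.p3 ^ 2 + x.t1 * x.p4 ^ 2 + x.p4 * x.v)
    - x.L125 * (x.t2 * x.p2 * x.p4 + x.p3 * x.u) - x.L126 * (x.t2 * x.p4 ^ 2 + x.p3 * x.v)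
    + x.L135 * (x.t1 * x.p2 * x.u - x.t2 * x.p1 * x.p2 + x.u ^ 2)
    + x.L136 * (x.t1 * (x.p4 * x.u + x.p2 * x.v) - x.t2 * (x.p2 * x.p3 + x.p1 * x.p4) + 2 * x.u * x.v)
    + x.L245 * (x.t1 * x.p4 * x.v - x.t2 * x.p3 * x.p4 + x.v ^ 2)

/-- The equation `F7`. -/
def F7 (x : PiTuple R) : R :=
    (-x.s2 ^ 2 + x.s1 * x.s3)
    + ((x.L123 * x.p2 + x.L124 * x.p4) * x.s1 - (x.L125 * x.p2 + x.L126 * x.p4) * x.s2)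
    + x.L123 * (x.L136 * x.p2 ^ 2 + 2 * x.L245 * x.p2 * x.p4 + x.L246 * x.p4 ^ 2)
    - x.L124 * (x.L135 * x.p2 ^ 2 + 2 * x.L136 * x.p2 * x.p4 + x.L245 * x.p4 ^ 2)
    - x.L125 * (x.L136 * x.p1 * x.p2 + x.L245 * (x.p2 * x.p3 + x.p1 * x.p4) + x.L246 * x.p3 * x.p4)
    + x.L126 * (x.L135 * x.p1 * x.p2 + x.L136 * (x.p2 * x.p3 + x.p1 * x.p4) + x.L245 * x.p3 * x.p4)
    + (x.L135 * x.L245 - x.L136 ^ 2) * (-x.p1 ^ 2 + 2 * x.u * x.p2 + x.t1 * x.p2 ^ 2)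
    + (x.L135 * x.L246 - x.L136 * x.L245) * (-x.p1 * x.p3 + x.u * x.p4 + x.v * x.p2 + x.t1 * x.p2 * x.p4)
    + (x.L136 * x.L246 - x.L245 ^ 2) * (-x.p3 ^ 2 + 2 * x.v * x.p4 + x.t1 * x.p4 ^ 2)

/-- The equation `F8`. -/
def F8 (x : PiTuple R) : R :=
    (x.s2 * x.s3 + x.t1 * x.s1 * x.s2 - x.t2 * x.s1 ^ 2)
    + x.s1 * (x.L123 * x.p1 + x.L124 * x.p3) - x.s2 * (x.L125 * x.p1 + x.L126 * x.p3)
    + x.L123 * (x.L136 * x.p1 * x.p2 + x.L245 * (x.p1 * x.p4 + x.p3 * x.p2) + x.L246 * x.p3 * x.p4)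
    - x.L124 * (x.L135 * x.p1 * x.p2 + x.L136 * (x.p1 * x.p4 + x.p3 * x.p2) + x.L245 * x.p3 * x.p4)
    - x.L125 * (x.L136 * x.p1 ^ 2 + 2 * x.L245 * x.p1 * x.p3 + x.L246 * x.p3 ^ 2)
    + x.L126 * (x.L135 * x.p1 ^ 2 + 2 * x.L136 * x.p1 * x.p3 + x.L245 * x.p3 ^ 2)
    + (-x.L136 ^ 2 + x.L135 * x.L245) * (2 * x.u * x.p1 + 2 * x.t1 * x.p1 * x.p2 - x.t2 * x.p2 ^ 2)
    + (x.L135 * x.L246 - x.L136 * x.L245) * ((x.v * x.p1 + x.u * x.p3) + x.t1 * (x.p1 * x.p4 + x.p3 * x.p2) - x.t2 * x.p2 * x.p4)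
    + (x.L246 * x.L136 - x.L245 ^ 2) * (2 * x.v * x.p3 + 2 * x.t1 * x.p3 * x.p4 - x.t2 * x.p4 ^ 2)

/-- The equation `F9`. -/
def F9 (x : PiTuple R) : R :=
    (x.t1 * x.s2 ^ 2 + x.s3 ^ 2 - x.s1 * x.s2 * x.t2) + x.s1 * (x.L123 * x.u + x.L124 * x.v)
    - x.s2 * (x.L125 * x.u + x.L126 * x.v)
    + (x.L124 * x.L125 - x.L123 * x.L126) * (-x.p2 * x.p3 + x.p1 * x.p4)
    - x.L123 * (x.L246 * (x.p3 ^ 2 + x.t1 * x.p4 ^ 2) + x.L136 * (x.p1 ^ 2 + x.t1 * x.p2 ^ 2) + 2 * x.L245 * (x.p1 * x.p3 + x.t1 * x.p2 * x.p4))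
    + x.L124 * (x.L135 * (x.p1 ^ 2 + x.t1 * x.p2 ^ 2) + 2 * x.L136 * (x.p1 * x.p3 + x.t1 * x.p2 * x.p4) + x.L245 * (x.p3 ^ 2 + x.t1 * x.p4 ^ 2))
    + x.L125 * x.t2 * (x.L246 * x.p4 ^ 2 + x.L136 * x.p2 ^ 2 + 2 * x.L245 * x.p2 * x.p4)
    - x.L126 * x.t2 * (x.L135 * x.p2 ^ 2 + 2 * x.L136 * x.p2 * x.p4 + x.L245 * x.p4 ^ 2)
    + (-x.L136 ^ 2 + x.L135 * x.L245) * (x.u ^ 2 + 2 * x.t2 * x.p1 * x.p2)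
    + (x.L135 * x.L246 - x.L136 * x.L245) * (x.u * x.v + x.t2 * (x.p2 * x.p3 + x.p1 * x.p4))
    + (x.L246 * x.L136 - x.L245 ^ 2) * (x.v ^ 2 + 2 * x.t2 * x.p3 * x.p4)

/-- The nine equations `F1, …, F9`. -/
def F (x : PiTuple R) : Fin 9 → R :=
  ![F1 x, F2 x, F3 x, F4 x, F5 x, F6 x, F7 x, F8 x, F9 x]

/-- `G` is a combination of `F1, …, F6`. -/
lemma G_eq (x : PiTuple R) : G x.toBaseTuple =
    (x.p3 * x.t2 - x.v * x.t1) * F1 x + (x.u * x.t1 - x.p1 * x.t2) * F2 x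
      + x.p4 * x.t2 * F3 x - x.p2 * x.t2 * F4 x - x.v * F5 x + x.u * F6 x := by
  simp only [G, D, Matrix.det_fin_three, Matrix.submatrix_apply, M, F1, F2, F3, F4, F5, F6, id]
  simp
  ring

end Equations

section Weights

/-- The relations between the weights `w(p1), …, w(s3)` of the nineteen variables and the weight
`wG` of `G` under which `F1, …, F9` (and `G`) are homogeneous. -/
structure WeightRel (w : PiTuple ℕ) (wG : ℕ) : Prop where
  p1 : (w.p1 : ℤ) = w.p3 + w.u - w.v
  p2 : (w.p2 : ℤ) = 2 * w.p3 + w.u - 2 * w.v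
  p4 : (w.p4 : ℤ) = 2 * w.p3 - w.v
  s1 : (w.s1 : ℤ) = wG - (w.u + 3 * w.v - 2 * w.p3)
  s2 : (w.s2 : ℤ) = wG - (w.u + 2 * w.v - w.p3)
  s3 : (w.s3 : ℤ) = wG - (w.u + w.v)
  t1 : (w.t1 : ℤ) = 2 * (w.v - w.p3)
  t2 : (w.t2 : ℤ) = 3 * (w.v - w.p3)
  L123 : (w.L123 : ℤ) = wG - (2 * w.p3 + 2 * w.u - w.v)
  L124 : (w.L124 : ℤ) = wG - (2 * w.p3 + w.u)
  L125 : (w.L125 : ℤ) = wG - (w.p3 + 2 * w.u)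
  L126 : (w.L126 : ℤ) = wG - (w.p3 + w.u + w.v)
  L135 : (w.L135 : ℤ) = wG - 3 * w.u
  L136 : (w.L136 : ℤ) = wG - (2 * w.u + w.v)
  L245 : (w.L245 : ℤ) = wG - (w.u + 2 * w.v)
  L246 : (w.L246 : ℤ) = wG - 3 * w.v

section Homogeneity

lemma htwo {A : Type*} [CommRing A] [Algebra ℂ A] {𝒜 : ℕ → Submodule ℂ A} {i : ℕ} {a : A}
    (ha : a ∈ 𝒜 i) : 2 * a ∈ 𝒜 i :=
  two_mul a ▸ add_mem ha ha

variable {A : Type*} [CommRing A] [Algebra ℂ A] {𝒜 : ℕ → Submodule ℂ A} [SetLike.GradedMonoid 𝒜]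

lemma hmul {i j n : ℕ} {a b : A} (ha : a ∈ 𝒜 i) (hb : b ∈ 𝒜 j) (h : i + j = n) : a * b ∈ 𝒜 n :=
  h ▸ SetLike.mul_mem_graded ha hb

lemma hsq {i n : ℕ} {a : A} (ha : a ∈ 𝒜 i) (h : i + i = n) : a ^ 2 ∈ 𝒜 n :=
  pow_two a ▸ hmul ha ha h

/-- The coordinates of `x` are homogeneous of the degrees prescribed by `w`. -/
structure HomTuple (𝒜 : ℕ → Submodule ℂ A) (x : PiTuple A) (w : PiTuple ℕ) : Prop where
  p1 : x.p1 ∈ 𝒜 w.p1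
  p2 : x.p2 ∈ 𝒜 w.p2
  p3 : x.p3 ∈ 𝒜 w.p3
  p4 : x.p4 ∈ 𝒜 w.p4
  u : x.u ∈ 𝒜 w.u
  v : x.v ∈ 𝒜 w.v
  t1 : x.t1 ∈ 𝒜 w.t1
  t2 : x.t2 ∈ 𝒜 w.t2
  L123 : x.L123 ∈ 𝒜 w.L123
  L124 : x.L124 ∈ 𝒜 w.L124
  L125 : x.L125 ∈ 𝒜 w.L125
  L126 : x.L126 ∈ 𝒜 w.L126
  L135 : x.L135 ∈ 𝒜 w.L135
  L136 : x.L136 ∈ 𝒜 w.L136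
  L245 : x.L245 ∈ 𝒜 w.L245
  L246 : x.L246 ∈ 𝒜 w.L246
  s1 : x.s1 ∈ 𝒜 w.s1
  s2 : x.s2 ∈ 𝒜 w.s2
  s3 : x.s3 ∈ 𝒜 w.s3

/-- The degrees of `F1, …, F9`. -/
def degF (w : PiTuple ℕ) : Fin 9 → ℕ :=
  ![w.u + w.s1, w.v + w.s1, w.u + w.s2, w.v + w.s2, w.u + w.s3, w.v + w.s3,
    w.s2 + w.s2, w.s2 + w.s3, w.s3 + w.s3]

set_option linter.unusedSimpArgs false in
set_option maxHeartbeats 4000000 in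
lemma F_mem {x : PiTuple A} {w : PiTuple ℕ} {g : ℕ} (h : HomTuple 𝒜 x w) (r : WeightRel w g)
    (i : Fin 9) : F x i ∈ 𝒜 (degF w i) := by
  have key : (F1 x ∈ 𝒜 (w.u + w.s1) ∧ F2 x ∈ 𝒜 (w.v + w.s1) ∧ F3 x ∈ 𝒜 (w.u + w.s2)) ∧
      (F4 x ∈ 𝒜 (w.v + w.s2) ∧ F5 x ∈ 𝒜 (w.u + w.s3) ∧ F6 x ∈ 𝒜 (w.v + w.s3)) ∧
      F7 x ∈ 𝒜 (w.s2 + w.s2) ∧ F8 x ∈ 𝒜 (w.s2 + w.s3) ∧ F9 x ∈ 𝒜 (w.s3 + w.s3) := by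
    obtain ⟨xp1, xp2, xp3, xp4, xu, xv, xt1, xt2, xL123, xL124, xL125, xL126, xL135, xL136, xL245, xL246, xs1, xs2, xs3⟩ := h
    obtain ⟨wp1, wp2, wp4, ws1, ws2, ws3, wt1, wt2, wL123, wL124, wL125, wL126, wL135, wL136, wL245, wL246⟩ := r
    unfold F1 F2 F3 F4 F5 F6 F7 F8 F9
    refine ⟨⟨?_, ?_, ?_⟩, ⟨?_, ?_, ?_⟩, ?_, ?_, ?_⟩
    all_goals repeat' first
      | assumption
      | (refine add_mem ?_ ?_) | (refine sub_mem ?_ ?_) | (refine neg_mem ?_) | (refine htwo ?_)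
      | (eapply hmul) | (eapply hsq) | rfl
      | (apply Nat.cast_injective (R := ℤ); simp only [Nat.cast_add, wp1, wp2, wp4, ws1, ws2, ws3, wt1, wt2, wL123, wL124, wL125, wL126, wL135, wL136, wL245, wL246]; ring)
  obtain ⟨⟨h1, h2, h3⟩, ⟨h4, h5, h6⟩, h7, h8, h9⟩ := key
  fin_cases i
  exacts [h1, h2, h3, h4, h5, h6, h7, h8, h9]

set_option linter.unusedSimpArgs false in
lemma G_mem {x : PiTuple A} {w : PiTuple ℕ} {g : ℕ} (h : HomTuple 𝒜 x w) (r : WeightRel w g) :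
    G x.toBaseTuple ∈ 𝒜 g := by
  have f1 : F1 x ∈ 𝒜 (w.u + w.s1) := F_mem h r 0
  have f2 : F2 x ∈ 𝒜 (w.v + w.s1) := F_mem h r 1
  have f3 : F3 x ∈ 𝒜 (w.u + w.s2) := F_mem h r 2
  have f4 : F4 x ∈ 𝒜 (w.v + w.s2) := F_mem h r 3
  have f5 : F5 x ∈ 𝒜 (w.u + w.s3) := F_mem h r 4
  have f6 : F6 x ∈ 𝒜 (w.v + w.s3) := F_mem h r 5
  obtain ⟨xp1, xp2, xp3, xp4, xu, xv, xt1, xt2, xL123, xL124, xL125, xL126, xL135, xL136, xL245, xL246, xs1, xs2, xs3⟩ := h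
  obtain ⟨wp1, wp2, wp4, ws1, ws2, ws3, wt1, wt2, wL123, wL124, wL125, wL126, wL135, wL136, wL245, wL246⟩ := r
  rw [G_eq]
  repeat' first
    | assumption
    | (refine add_mem ?_ ?_) | (refine sub_mem ?_ ?_) | (eapply hmul) | rfl
    | (apply Nat.cast_injective (R := ℤ); simp only [Nat.cast_add, wp1, wp2, wp4, ws1, ws2, ws3, wt1, wt2, wL123, wL124, wL125, wL126, wL135, wL136, wL245, wL246]; ring)

end Homogeneity

end Weights

section Varieties

/-- The base coordinates `p1, …, L245` other than `L246` (which is set to `1`). -/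
inductive BaseVar : Type
  | p1 | p2 | p3 | p4 | u | v | t1 | t2 | L123 | L124 | L125 | L126 | L135 | L136 | L245

/-- The entry of a tuple named by a base coordinate. -/
def BaseTuple.get {R : Type*} (x : BaseTuple R) : BaseVar → R
  | .p1 => x.p1 | .p2 => x.p2 | .p3 => x.p3 | .p4 => x.p4 | .u => x.u | .v => x.v
  | .t1 => x.t1 | .t2 => x.t2 | .L123 => x.L123 | .L124 => x.L124 | .L125 => x.L125
  | .L126 => x.L126 | .L135 => x.L135 | .L136 => x.L136 | .L245 => x.L245

/-- The tuple with the given base coordinates and with `L246 = 1`. -/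
def BaseTuple.ofFun {R : Type*} [One R] (f : BaseVar → R) : BaseTuple R :=
  ⟨f .p1, f .p2, f .p3, f .p4, f .u, f .v, f .t1, f .t2, f .L123, f .L124, f .L125, f .L126,
    f .L135, f .L136, f .L245, 1⟩

lemma map_G {R S : Type*} [CommRing R] [CommRing S] (φ : R →+* S) (f : BaseVar → R) :
    φ (G (.ofFun f)) = G (.ofFun fun b => φ (f b)) := by
  have hM : M (.ofFun fun b => φ (f b)) = (M (.ofFun f)).map φ := by
    ext i j
    fin_cases i <;> fin_cases j <;> simp [M, BaseTuple.ofFun]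
  have hD : ∀ i j k, φ (D (.ofFun f) i j k) = D (.ofFun fun b => φ (f b)) i j k := by
    intro i j k
    rw [D, D, hM, RingHom.map_det]
    rfl
  simp only [G, map_add, map_mul, map_ofNat, hD]
  simp [BaseTuple.ofFun]

/-- A system of weights of the coordinates for which `F1, …, F9` are homogeneous after setting
`L246 = 1`: the weight of `L246` is `0`, all other weights are positive. -/
structure Weights where
  wt : PiTuple ℕ
  wG : ℕ
  rel : WeightRel wt wG
  L246_eq_zero : wt.L246 = 0
  get_pos : ∀ b : BaseVar, 0 < wt.get b
  s1_pos : 0 < wt.s1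
  s2_pos : 0 < wt.s2
  s3_pos : 0 < wt.s3

/-- The coordinates of the ambient space of the hypersurface: the fifteen base coordinates and `m`
cone coordinates. -/
abbrev HypVar (m : ℕ) : Type := BaseVar ⊕ Fin m

/-- The coordinates of the ambient space of the key variety: in addition `s1, s2, s3`
(which are `Sum.inr 0`, `Sum.inr 1`, `Sum.inr 2`). -/
abbrev PiVar (m : ℕ) : Type := HypVar m ⊕ Fin 3

abbrev HypPoly (m : ℕ) : Type := MvPolynomial (HypVar m) ℂ

abbrev PiPoly (m : ℕ) : Type := MvPolynomial (PiVar m) ℂ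

noncomputable section

/-- The indeterminates, with `L246 = 1`. -/
def hypGen (m : ℕ) : BaseTuple (HypPoly m) := .ofFun fun b => MvPolynomial.X (.inl b)

/-- The indeterminates, with `L246 = 1`. -/
def piGen (m : ℕ) : PiTuple (PiPoly m) where
  toBaseTuple := .ofFun fun b => MvPolynomial.X (.inl (.inl b))
  s1 := MvPolynomial.X (.inr 0)
  s2 := MvPolynomial.X (.inr 1)
  s3 := MvPolynomial.X (.inr 2)

variable (W : Weights) (m : ℕ)

/-- The cone coordinates have weight one. -/
def Weights.hyp : HypVar m → ℕ := Sum.elim W.wt.get fun _ => 1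

def Weights.pi : PiVar m → ℕ := Sum.elim (W.hyp m) ![W.wt.s1, W.wt.s2, W.wt.s3]

instance {σ : Type*} (w : σ → ℕ) :
    GradedAlgebra (MvPolynomial.weightedHomogeneousSubmodule ℂ w) :=
  MvPolynomial.weightedGradedAlgebra ℂ w

abbrev hypPolyGrading : ℕ → Submodule ℂ (HypPoly m) :=
  MvPolynomial.weightedHomogeneousSubmodule ℂ (W.hyp m)

abbrev piPolyGrading : ℕ → Submodule ℂ (PiPoly m) :=
  MvPolynomial.weightedHomogeneousSubmodule ℂ (W.pi m)

lemma X_mem {σ : Type*} {w : σ → ℕ} {i : σ} {n : ℕ} (h : w i = n) :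
    (MvPolynomial.X i : MvPolynomial σ ℂ) ∈ MvPolynomial.weightedHomogeneousSubmodule ℂ w n :=
  h ▸ MvPolynomial.isWeightedHomogeneous_X ℂ w i

lemma homTuple_piGen : HomTuple (piPolyGrading W m) (piGen m) W.wt := by
  constructor
  case L246 =>
    rw [W.L246_eq_zero]
    exact SetLike.GradedOne.one_mem
  all_goals exact X_mem rfl

lemma homTuple_hypGen : HomTuple (hypPolyGrading W m) ⟨hypGen m, 0, 0, 0⟩ W.wt := by
  constructor
  case L246 =>
    rw [W.L246_eq_zero]
    exact SetLike.GradedOne.one_mem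
  case s1 => exact zero_mem _
  case s2 => exact zero_mem _
  case s3 => exact zero_mem _
  all_goals exact X_mem rfl

lemma G_hypGen_mem : G (hypGen m) ∈ hypPolyGrading W m W.wG :=
  G_mem (𝒜 := hypPolyGrading W m) (x := ⟨hypGen m, 0, 0, 0⟩) (homTuple_hypGen W m) W.rel

lemma F_piGen_mem (i : Fin 9) : F (piGen m) i ∈ piPolyGrading W m (degF W.wt i) :=
  F_mem (𝒜 := piPolyGrading W m) (homTuple_piGen W m) W.rel i

/-- The homogeneous ideal generated by `G` with `L246 = 1`. -/
def hypIdeal : HomogeneousIdeal (hypPolyGrading W m) where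
  toSubmodule := Ideal.span {G (hypGen m)}
  is_homogeneous' := Ideal.homogeneous_span _ _ (by
    rintro _ rfl
    exact ⟨_, G_hypGen_mem W m⟩)

/-- The homogeneous ideal generated by `F1, …, F9` with `L246 = 1`. -/
def piIdeal : HomogeneousIdeal (piPolyGrading W m) where
  toSubmodule := Ideal.span (Set.range (F (piGen m)))
  is_homogeneous' := Ideal.homogeneous_span _ _ (by
    rintro _ ⟨i, rfl⟩
    exact ⟨_, F_piGen_mem W m i⟩)

/-- The homogeneous coordinate ring of the hypersurface. -/
abbrev HypRing : Type := HypPoly m ⧸ (hypIdeal W m).toIdeal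

/-- The homogeneous coordinate ring of the key variety. -/
abbrev PiRing : Type := PiPoly m ⧸ (piIdeal W m).toIdeal

abbrev hypGrading : ℕ → Submodule ℂ (HypRing W m) := quotGrading (hypPolyGrading W m) (hypIdeal W m)

abbrev piGrading : ℕ → Submodule ℂ (PiRing W m) := quotGrading (piPolyGrading W m) (piIdeal W m)

/-- The weighted hypersurface `{G = 0}` with `L246 = 1` if `m = 0`, and the weighted cone over it
with a coordinate of weight one added if `m = 1`. -/
abbrev HypP : Scheme := Proj (hypGrading W m)

/-- The weighted projectivization `Π_ℙ^{13}` of `Π_𝔸^{14} = {F1 = ⋯ = F9 = 0, L246 = 1}` if `m = 0`,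
and the weighted cone `Π_ℙ^{14}` over it with a coordinate of weight one added if `m = 1`. -/
abbrev PiP : Scheme := Proj (piGrading W m)

lemma rename_mem {n : ℕ} {f : HypPoly m} (hf : f ∈ hypPolyGrading W m n) :
    MvPolynomial.rename Sum.inl f ∈ piPolyGrading W m n := by
  rw [MvPolynomial.mem_weightedHomogeneousSubmodule] at hf ⊢
  intro d hd
  obtain ⟨e, rfl, he⟩ := MvPolynomial.coeff_rename_ne_zero _ _ _ hd
  rw [← hf he]
  simp [Finsupp.weight_apply, Finsupp.sum_mapDomain_index, add_mul, Weights.pi]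

lemma rename_G : MvPolynomial.rename Sum.inl (G (hypGen m)) = G (piGen m).toBaseTuple := by
  have h : G (piGen m).toBaseTuple = G (.ofFun fun b =>
      MvPolynomial.rename (R := ℂ) (Sum.inl : HypVar m → PiVar m) (MvPolynomial.X (.inl b))) := by
    simp only [MvPolynomial.rename_X]
    rfl
  rw [h]
  exact map_G (MvPolynomial.rename (R := ℂ) (Sum.inl : HypVar m → PiVar m)).toRingHom _

lemma rename_mem_piIdeal {f : HypPoly m} (hf : f ∈ (hypIdeal W m).toIdeal) :
    MvPolynomial.rename Sum.inl f ∈ (piIdeal W m).toIdeal := by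
  have h : (hypIdeal W m).toIdeal ≤ (piIdeal W m).toIdeal.comap
      (MvPolynomial.rename (R := ℂ) (Sum.inl : HypVar m → PiVar m)).toRingHom := by
    refine Ideal.span_le.2 ?_
    rintro _ rfl
    change MvPolynomial.rename Sum.inl (G (hypGen m)) ∈ (piIdeal W m).toIdeal
    have hF : ∀ i, F (piGen m) i ∈ (piIdeal W m).toIdeal := fun i => Ideal.subset_span ⟨i, rfl⟩
    rw [rename_G, G_eq]
    exact add_mem (sub_mem (sub_mem (add_mem (add_mem (Ideal.mul_mem_left _ _ (hF 0))
      (Ideal.mul_mem_left _ _ (hF 1))) (Ideal.mul_mem_left _ _ (hF 2)))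
      (Ideal.mul_mem_left _ _ (hF 3))) (Ideal.mul_mem_left _ _ (hF 4)))
      (Ideal.mul_mem_left _ _ (hF 5))
  exact h hf

/-- The homomorphism of graded rings that sends each coordinate of the ambient space of the
hypersurface to the coordinate of the same name. -/
def coordHom : hypGrading W m →+*ᵍ piGrading W m where
  toRingHom := Ideal.quotientMap (piIdeal W m).toIdeal
    (MvPolynomial.rename (R := ℂ) (Sum.inl : HypVar m → PiVar m)).toRingHom
    fun _ hf => rename_mem_piIdeal W m hf
  map_mem := by
    rintro n _ ⟨f, hf, rfl⟩
    exact ⟨_, rename_mem W m hf, rfl⟩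

/-- The class of a coordinate in the homogeneous coordinate ring of the key variety. -/
def coord (i : PiVar m) : PiRing W m := Ideal.Quotient.mk _ (MvPolynomial.X i)

/-- The class of the minor `D_{ijk}` (columns numbered from `0` to `5`). -/
def minor (i j k : Fin 6) : PiRing W m := Ideal.Quotient.mk _ (D (piGen m).toBaseTuple i j k)

/-- The closed subset of the key variety where the given elements vanish. -/
def vanishing (S : Set (PiRing W m)) : Set (PiP W m) :=
  {x | ∀ f ∈ S, x ∉ Proj.basicOpen (piGrading W m) f}

/-- The points of the key variety on `ℙ(s1, s2, s3)`: all coordinates other than `s1, s2, s3`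
vanish. -/
def center : Set (PiP W m) := vanishing W m (Set.range fun i => coord W m (.inl i))

/-- `x` is the `s1`-point: all coordinates other than `s1` vanish at `x`. -/
def IsS1Point (x : PiP W m) : Prop :=
  (∀ i, i ≠ .inr 0 → x ∉ Proj.basicOpen (piGrading W m) (coord W m i)) ∧
    x ∈ Proj.basicOpen (piGrading W m) (coord W m (.inr 0))

/-- The ring of the chart `s1 = 1` of the affine cone over the scheme-theoretic intersection of the
key variety with `ℙ(s1, s2, s3)`; its spectrum is the cover of this intersection by the local index
cover at the `s1`-point. -/
abbrev CenterChart : Type :=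
  PiPoly m ⧸ ((piIdeal W m).toIdeal ⊔
    Ideal.span (Set.range fun i : HypVar m => (MvPolynomial.X (.inl i) : PiPoly m)) ⊔
    Ideal.span {MvPolynomial.X (.inr 0) - 1})

/-- The open subset of the key variety on which the projection is defined. -/
def piDomain : (PiP W m).Opens := projDomain (coordHom W m)

/-- The projection that forgets `s1, s2, s3`. -/
def piProjection : (piDomain W m).toScheme ⟶ HypP W m := projection (coordHom W m)

/-- The locus where the minors `D_{ijk}`, `1 ≤ i < j < k ≤ 6`, all vanish. -/
def minorLocus : Set (PiP W m) :=
  vanishing W m {f | ∃ i j k : Fin 6, i < j ∧ j < k ∧ f = minor W m i j k}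

end

end Varieties

section Birational

variable {X Y : Scheme}

/-- A morphism `π` from an open subscheme `U` of `X` to `Y` is birational, as a map from `X`
to `Y`: it restricts to an isomorphism of a dense open subscheme of `X` with one of `Y`. -/
def IsBirationalMap {U : X.Opens} (π : U.toScheme ⟶ Y) : Prop :=
  ∃ (e : Scheme.PartialIso X Y) (h : e.source ≤ U), e.iso.hom ≫ e.target.ι = X.homOfLE h ≫ π

/-- The set of points of `X` near which `π` is not an isomorphism onto an open subscheme of `Y`;
it contains the points where `π` is not defined. -/
def exceptionalLocus {U : X.Opens} (π : U.toScheme ⟶ Y) : Set X :=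
  {x | ¬ ∃ (V : X.Opens) (h : V ≤ U), x ∈ V ∧ IsOpenImmersion (X.homOfLE h ≫ π)}

end Birational

end KeyVariety

/-!
The cubic algebra `A = R[θ]`, `θ³ = t2 - t1 θ`, organizes the equations. Put
`α = u - p1 θ - p2 θ²` and `β = v - p3 θ - p4 θ²`. The columns of `M` are `α, β, θα, θβ,
(θ² + t1)α, (θ² + t1)β`, and `F1, …, F6` prescribe the values on the submodule `αA + βA` of a linear
form `s : A → R` with coordinates `s1, s2, s3`.

*Isomorphism off the minors.* Where a minor `D_{ijk}` is invertible, `α` and `β` generate the unit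
ideal of `A`, so the Koszul complex of `(α, β)` is exact. Hence the linear equations determine `s`,
and they are solvable as soon as the prescribed values vanish on the Koszul relations
`(θʳβ, -θʳα)`; this holds identically for `r = 0, 1`, and for `r = 2` the condition is `G = 0`
(`vecMul_solve_rhs`). The quadrics `F7, F8, F9` follow from the linear equations, because modulo
these the vector `(F7, F8, 2 F9 + t1 F7)` is killed by the columns of `M` (`vecMul_quadrics`). So the
two coordinate rings become isomorphic after inverting `D_{ijk}`, and the exceptional locus lies in
the common zero set of the minors (`exceptionalLocus_subset_minorLocus`).

*Density.* The minor `D_{135}`, which is the norm of `α`, is a nonzerodivisor in both coordinate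
rings (`minor_regular`). Regard all base coordinates but `p3` and `v` as parameters, and let `R` be
the polynomial ring in the parameters with `D_{135}` inverted. Both coordinate rings map to
`R[p3, v] / (G)`, which is free over `R` on the monomials `p3ᵏ vᵇ`, `b < 3`, as `G` is monic in
`v`. The equations show that the coordinate ring of the key variety is spanned by
`1, v, p3, s2, s3, v s2` over the parameters and `s1` (`mul_mem_span_piSpan`). At the point where
`α = 1` and all other parameters vanish, `s1, s2, s3` become `p3², p3 v, v²`, and the spanning family
becomes the monomial basis; by Nakayama's lemma its image is linearly independent over `R`. So both
coordinate rings embed into a ring in which `D_{135}` is a unit.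

*The `s1`-point.* When all coordinates but `s1, s2, s3` vanish, the equations reduce to
`s2² = s1 s3`, `s2 s3 = 0`, `s3² = 0` (`F_center`). Set-theoretically this leaves the `s1`-point, and
for `s1 = 1` the ring is `ℂ[s2] / (s2³)`.
-/

namespace KeyVariety

/-! ### The cubic algebra and the equations -/

section Identities

variable {R S : Type*} [CommRing R] [CommRing S]

/-- The image of a tuple under a ring homomorphism. -/
def BaseTuple.map (φ : R →+* S) (x : BaseTuple R) : BaseTuple S :=
  ⟨φ x.p1, φ x.p2, φ x.p3, φ x.p4, φ x.u, φ x.v, φ x.t1, φ x.t2, φ x.L123, φ x.L124, φ x.L125,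
    φ x.L126, φ x.L135, φ x.L136, φ x.L245, φ x.L246⟩

/-- The image of a tuple under a ring homomorphism. -/
def PiTuple.map (φ : R →+* S) (x : PiTuple R) : PiTuple S :=
  ⟨x.toBaseTuple.map φ, φ x.s1, φ x.s2, φ x.s3⟩

lemma F_map (φ : R →+* S) (x : PiTuple R) (i : Fin 9) : F (x.map φ) i = φ (F x i) := by
  have two : φ 2 = 2 := map_ofNat φ 2
  have h1 : F1 (x.map φ) = φ (F1 x) := by simp [F1, PiTuple.map, BaseTuple.map, two]
  have h2 : F2 (x.map φ) = φ (F2 x) := by simp [F2, PiTuple.map, BaseTuple.map, two]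
  have h3 : F3 (x.map φ) = φ (F3 x) := by simp [F3, PiTuple.map, BaseTuple.map, two]
  have h4 : F4 (x.map φ) = φ (F4 x) := by simp [F4, PiTuple.map, BaseTuple.map, two]
  have h5 : F5 (x.map φ) = φ (F5 x) := by simp [F5, PiTuple.map, BaseTuple.map, two]
  have h6 : F6 (x.map φ) = φ (F6 x) := by simp [F6, PiTuple.map, BaseTuple.map, two]
  have h7 : F7 (x.map φ) = φ (F7 x) := by simp [F7, PiTuple.map, BaseTuple.map, two]
  have h8 : F8 (x.map φ) = φ (F8 x) := by simp [F8, PiTuple.map, BaseTuple.map, two]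
  have h9 : F9 (x.map φ) = φ (F9 x) := by simp [F9, PiTuple.map, BaseTuple.map, two]
  fin_cases i
  exacts [h1, h2, h3, h4, h5, h6, h7, h8, h9]

lemma M_map (φ : R →+* S) (x : BaseTuple R) : M (x.map φ) = (M x).map φ := by
  ext i j
  fin_cases i <;> fin_cases j <;> simp [M, BaseTuple.map]

lemma D_map (φ : R →+* S) (x : BaseTuple R) (i j k : Fin 6) :
    D (x.map φ) i j k = φ (D x i j k) := by
  rw [D, D, M_map, RingHom.map_det]
  rfl

lemma G_map (φ : R →+* S) (x : BaseTuple R) : G (x.map φ) = φ (G x) := by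
  simp only [G, map_add, map_mul, map_ofNat, ← D_map]
  rfl

/-- The part of `F1, F2, F3, F4, F5 + t1 F1, F6 + t1 F2` free of `s1, s2, s3`, with the opposite
sign. The last two equations are modified so that the coefficients of `s1, s2, s3` in the six
equations are the columns of `M`. -/
def rhs (x : BaseTuple R) : Fin 6 → R :=
  ![-F1 ⟨x, 0, 0, 0⟩, -F2 ⟨x, 0, 0, 0⟩, -F3 ⟨x, 0, 0, 0⟩, -F4 ⟨x, 0, 0, 0⟩,
    -(F5 ⟨x, 0, 0, 0⟩ + x.t1 * F1 ⟨x, 0, 0, 0⟩), -(F6 ⟨x, 0, 0, 0⟩ + x.t1 * F2 ⟨x, 0, 0, 0⟩)]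

lemma rhs_map (φ : R →+* S) (x : BaseTuple R) : rhs (x.map φ) = φ ∘ rhs x := by
  have h : (⟨x.map φ, 0, 0, 0⟩ : PiTuple S) = PiTuple.map φ ⟨x, 0, 0, 0⟩ := by
    simp [PiTuple.map]
  have hF := F_map φ ⟨x, 0, 0, 0⟩
  have ht : (x.map φ).t1 = φ x.t1 := rfl
  funext i
  fin_cases i
  · simpa [rhs, h, F] using hF 0
  · simpa [rhs, h, F] using hF 1
  · simpa [rhs, h, F] using hF 2
  · simpa [rhs, h, F] using hF 3
  · have h1 := hF 4
    have h2 := hF 0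
    simp only [F] at h1 h2
    simp [rhs, h, ht] at h1 h2 ⊢
    rw [h1, h2, add_comm]
  · have h1 := hF 5
    have h2 := hF 1
    simp only [F] at h1 h2
    simp [rhs, h, ht] at h1 h2 ⊢
    rw [h1, h2, add_comm]

/-- The first six equations are the linear system `s M = rhs` for the row vector `s`. -/
lemma vecMul_M_sub_rhs (x : PiTuple R) :
    Matrix.vecMul ![x.s1, x.s2, x.s3] (M x.toBaseTuple) - rhs x.toBaseTuple =
      ![F1 x, F2 x, F3 x, F4 x, F5 x + x.t1 * F1 x, F6 x + x.t1 * F2 x] := by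
  funext i
  fin_cases i <;> simp [M, rhs, F1, F2, F3, F4, F5, F6] <;> ring

lemma vecMul_M_eq_rhs {x : PiTuple R} (h : ∀ i, F x i = 0) :
    Matrix.vecMul ![x.s1, x.s2, x.s3] (M x.toBaseTuple) = rhs x.toBaseTuple := by
  have h1 : F1 x = 0 := h 0
  have h2 : F2 x = 0 := h 1
  have h3 : F3 x = 0 := h 2
  have h4 : F4 x = 0 := h 3
  have h5 : F5 x = 0 := h 4
  have h6 : F6 x = 0 := h 5
  rw [← sub_eq_zero, vecMul_M_sub_rhs, h1, h2, h3, h4, h5, h6]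
  simp

/-- Let `A` be the cubic algebra `R[θ]` with `θ³ = t2 - t1 θ`, and put `α = u - p1 θ - p2 θ²`,
`β = v - p3 θ - p4 θ²`. The columns of `M` are the coordinates of `α, β, θα, θβ, (θ² + t1)α,
(θ² + t1)β`. A vector `w` on these columns thus represents a pair `(γ, δ)` in `A²`, with
`M w = γα + δβ`, and `thetaVec x w` represents `(θγ, θδ)`. -/
def thetaVec (x : BaseTuple R) (w : Fin 6 → R) : Fin 6 → R :=
  ![x.t2 * w 4 - x.t1 * w 2, x.t2 * w 5 - x.t1 * w 3, w 0, w 1, w 2, w 3]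

lemma M_mulVec_thetaVec (x : BaseTuple R) (w : Fin 6 → R) :
    (M x).mulVec (thetaVec x w) = ![x.t2 * (M x).mulVec w 2,
      (M x).mulVec w 0 - x.t1 * (M x).mulVec w 2, (M x).mulVec w 1] := by
  funext i
  fin_cases i <;> simp [Matrix.mulVec, dotProduct, Fin.sum_univ_six, M, thetaVec] <;> ring

/-- The solution of `s M = b` built from `w` with `M w` the first unit vector: if `w` represents
`(γ, δ)`, then `s` is the functional `c ↦ b(γc, δc)` on `A`. -/
def solve (x : BaseTuple R) (w b : Fin 6 → R) : Fin 3 → R :=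
  ![b ⬝ᵥ w, b ⬝ᵥ thetaVec x w, b ⬝ᵥ thetaVec x (thetaVec x w)]

/-- If `s M = b` and `M w = d e₁`, then `d s` is computed from `w` and `b` alone. -/
lemma smul_eq_solve {x : BaseTuple R} {s : Fin 3 → R} {w : Fin 6 → R} {d : R}
    (hw : (M x).mulVec w = ![d, 0, 0]) : d • s = solve x w (Matrix.vecMul s (M x)) := by
  have h1 := M_mulVec_thetaVec x w
  have h2 := M_mulVec_thetaVec x (thetaVec x w)
  rw [h1, hw] at h2
  rw [hw] at h1
  simp only [solve, ← Matrix.dotProduct_mulVec, hw, h1, h2]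
  funext i
  fin_cases i <;> simp [dotProduct, Fin.sum_univ_three, mul_comm]

/-- A functional on `A²` that kills the Koszul relations `(θʳβ, -θʳα)` is of the form
`(a, b) ↦ s(αa + βb)` as soon as `α` and `β` generate the unit ideal of `A`: the Koszul complex
of `(α, β)` is then exact. -/
lemma vecMul_solve {x : BaseTuple R} {w b : Fin 6 → R} (hw : (M x).mulVec w = ![1, 0, 0])
    (k0 : x.v * b 0 - x.p3 * b 2 - x.p4 * (b 4 - x.t1 * b 0)
      - (x.u * b 1 - x.p1 * b 3 - x.p2 * (b 5 - x.t1 * b 1)) = 0)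
    (k1 : x.v * b 2 - x.p3 * (b 4 - x.t1 * b 0) - x.p4 * (x.t2 * b 0 - x.t1 * b 2)
      - (x.u * b 3 - x.p1 * (b 5 - x.t1 * b 1) - x.p2 * (x.t2 * b 1 - x.t1 * b 3)) = 0)
    (k2 : x.v * (b 4 - x.t1 * b 0) - x.p3 * (x.t2 * b 0 - x.t1 * b 2)
      - x.p4 * (x.t2 * b 2 - x.t1 * (b 4 - x.t1 * b 0))
      - (x.u * (b 5 - x.t1 * b 1) - x.p1 * (x.t2 * b 1 - x.t1 * b 3)
        - x.p2 * (x.t2 * b 3 - x.t1 * (b 5 - x.t1 * b 1))) = 0) :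
    Matrix.vecMul (solve x w b) (M x) = b := by
  have h0 := congrFun hw 0
  have h1 := congrFun hw 1
  have h2 := congrFun hw 2
  simp [Matrix.mulVec, dotProduct, Fin.sum_univ_six, M] at h0 h1 h2
  funext i
  fin_cases i <;>
    simp [Matrix.vecMul, dotProduct, Fin.sum_univ_three, Fin.sum_univ_six, M, solve, thetaVec]
  · linear_combination b 0 * h0 + b 2 * h1 + (b 4 - x.t1 * b 0) * h2
      - (w 1 + x.t1 * w 5) * k0 - w 3 * k1 - w 5 * k2
  · linear_combination b 1 * h0 + b 3 * h1 + (b 5 - x.t1 * b 1) * h2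
      + (w 0 + x.t1 * w 4) * k0 + w 2 * k1 + w 4 * k2
  · linear_combination b 2 * h0 + (b 4 - x.t1 * b 0) * h1 + (x.t2 * b 0 - x.t1 * b 2) * h2
      - x.t2 * w 5 * k0 - w 1 * k1 - w 3 * k2
  · linear_combination b 3 * h0 + (b 5 - x.t1 * b 1) * h1 + (x.t2 * b 1 - x.t1 * b 3) * h2
      + x.t2 * w 4 * k0 + w 0 * k1 + w 2 * k2
  · linear_combination b 4 * h0 + x.t2 * b 0 * h1 + x.t2 * b 2 * h2
      - (x.t2 * w 3 + x.t1 * w 1 + x.t1 ^ 2 * w 5) * k0 - x.t2 * w 5 * k1 - (w 1 + x.t1 * w 5) * k2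
  · linear_combination b 5 * h0 + x.t2 * b 1 * h1 + x.t2 * b 3 * h2
      + (x.t2 * w 2 + x.t1 * w 0 + x.t1 ^ 2 * w 4) * k0 + x.t2 * w 4 * k1 + (w 0 + x.t1 * w 4) * k2

/-- The functional `rhs` kills the Koszul relations, up to the multiple `G` in the last one. -/
lemma vecMul_solve_rhs {x : BaseTuple R} {w : Fin 6 → R} (hw : (M x).mulVec w = ![1, 0, 0])
    (hG : G x = 0) : Matrix.vecMul (solve x w (rhs x)) (M x) = rhs x := by
  have hG' := (G_eq ⟨x, 0, 0, 0⟩).symm.trans hG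
  refine vecMul_solve hw ?_ ?_ ?_
  · simp [rhs, F1, F2, F3, F4, F5, F6]; ring
  · simp [rhs, F1, F2, F3, F4, F5, F6]; ring
  · refine Eq.trans ?_ hG'
    simp [rhs, F1, F2, F3, F4, F5, F6]; ring

/-- Modulo `F1, …, F6` the vector `(F7, F8, 2 F9 + t1 F7)` is killed by the columns of `M`. To see
why in terms of `A`, let `σ` be the element of `A` for which `s(c)` is the coefficient of `θ²` in
`σc`. The terms of the vector free of `L123, …, L246` represent `σ(tr σ - σ)` in the same way, and
`F1, …, F6` say that `α` and `β` kill `σ` up to terms in the `L`'s; the identities correct this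
observation by those terms. -/
lemma vecMul_quadrics {x : PiTuple R} (h1 : F1 x = 0) (h2 : F2 x = 0) (h3 : F3 x = 0)
    (h4 : F4 x = 0) (h5 : F5 x = 0) (h6 : F6 x = 0) :
    Matrix.vecMul ![F7 x, F8 x, 2 * F9 x + x.t1 * F7 x] (M x.toBaseTuple) = 0 := by
  simp only [F1] at h1
  simp only [F2] at h2
  simp only [F3] at h3
  simp only [F4] at h4
  simp only [F5] at h5
  simp only [F6] at h6
  funext i
  fin_cases i <;> simp [Matrix.vecMul, dotProduct, Fin.sum_univ_three, M, F7, F8, F9]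
  · linear_combination (-x.p1 * x.L125 - x.p2 * x.t1 * x.L136 - x.p4 * x.t1 * x.L245 + x.p4 *
      x.L124 - x.u * x.L136 - 2 * x.v * x.L245 + 2 * x.s3) * h1 + (-x.p1 * x.L126 - x.p2 * x.t1 *
      x.L245 - x.p2 * x.L124 - x.p4 * x.t1 * x.L246 - x.v * x.L246) * h2 + (-2 * x.p1 * x.L136 +
      x.p2 * x.L125 - x.p3 * x.L245 - x.p4 * x.L126 - x.s2) * h3 + (-3 * x.p1 * x.L245 + 2 * x.p2 *
      x.L126 - 2 * x.p3 * x.L246) * h4 + (x.p2 * x.L136 + 2 * x.p4 * x.L245 - x.s1) * h5 + (x.p4 *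
      x.L246) * h6
  · linear_combination (x.p2 * x.t1 * x.L135 - x.p3 * x.L125 + x.p4 * x.t1 * x.L136 - x.p4 *
      x.L123 + x.u * x.L135 + 2 * x.v * x.L136) * h1 + (x.p2 * x.t1 * x.L136 + x.p2 * x.L123 - x.p3
      * x.L126 + x.p4 * x.t1 * x.L245 + x.v * x.L245 + 2 * x.s3) * h2 + (2 * x.p1 * x.L135 + x.p3 *
      x.L136 + 2 * x.p4 * x.L125) * h3 + (3 * x.p1 * x.L136 - x.p2 * x.L125 + 2 * x.p3 * x.L245 +
      x.p4 * x.L126 - x.s2) * h4 + (-x.p2 * x.L135 - 2 * x.p4 * x.L136) * h5 + (-x.p4 * x.L245 -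
      x.s1) * h6
  · linear_combination (x.p1 * x.t1 * x.L136 - x.p1 * x.L123 - 2 * x.p2 * x.t2 * x.L136 + x.p3 *
      x.t1 * x.L245 + x.p3 * x.L124 - x.p4 * x.t2 * x.L245 - x.t2 * x.s1) * h1 + (x.p1 * x.t1 *
      x.L245 - 2 * x.p1 * x.L124 - 3 * x.p2 * x.t2 * x.L245 + x.p3 * x.t1 * x.L246 - 2 * x.p4 * x.t2
      * x.L246) * h2 + (x.p2 * x.L123 - x.p3 * x.L126 - x.p4 * x.t1 * x.L245 - x.u * x.L136 - 2 *
      x.v * x.L245 + x.t1 * x.s1 + 2 * x.s3) * h3 + (x.p1 * x.L126 + x.p2 * x.t1 * x.L245 + x.p2 *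
      x.L124 - x.v * x.L246) * h4 + (x.p1 * x.L136 + 2 * x.p3 * x.L245 - x.s2) * h5 + (x.p3 *
      x.L246) * h6
  · linear_combination (-x.p1 * x.t1 * x.L135 + 2 * x.p2 * x.t2 * x.L135 - x.p3 * x.t1 * x.L136 -
      2 * x.p3 * x.L123 + x.p4 * x.t2 * x.L136) * h1 + (-x.p1 * x.t1 * x.L136 + x.p1 * x.L123 + 3 *
      x.p2 * x.t2 * x.L136 - x.p3 * x.t1 * x.L245 - x.p3 * x.L124 + 2 * x.p4 * x.t2 * x.L245 - x.t2
      * x.s1) * h2 + (x.p3 * x.L125 + x.p4 * x.t1 * x.L136 + x.p4 * x.L123 + x.u * x.L135 + 2 * x.v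
      * x.L136) * h3 + (-x.p1 * x.L125 - x.p2 * x.t1 * x.L136 + x.p4 * x.L124 + x.v * x.L245 + x.t1
      * x.s1 + 2 * x.s3) * h4 + (-x.p1 * x.L135 - 2 * x.p3 * x.L136) * h5 + (-x.p3 * x.L245 - x.s2)
      * h6
  · linear_combination (x.p1 * x.t2 * x.L136 + 2 * x.p2 * x.t1 * x.L123 - 2 * x.p2 * x.t2 * x.L125
      + x.p3 * x.t2 * x.L245 + 2 * x.p4 * x.t1 * x.L124 + 2 * x.u * x.L123 - 2 * x.v * x.t1 * x.L245
      + 2 * x.v * x.L124 + 2 * x.t1 * x.s3 - x.t2 * x.s2) * h1 + (x.p1 * x.t2 * x.L245 - 2 * x.p2 *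
      x.t2 * x.L126 + x.p3 * x.t2 * x.L246 + 2 * x.u * x.t1 * x.L245) * h2 + (-2 * x.p1 * x.t1 *
      x.L136 + 2 * x.p1 * x.L123 + x.p2 * x.t2 * x.L136 - 2 * x.p4 * x.t1 * x.L126 + x.p4 * x.t2 *
      x.L245 - 2 * x.u * x.L125 - 2 * x.v * x.L126 - x.t2 * x.s1) * h3 + (-4 * x.p1 * x.t1 * x.L245
      + 2 * x.p1 * x.L124 + 2 * x.p2 * x.t1 * x.L126 + x.p2 * x.t2 * x.L245 - 2 * x.p3 * x.t1 *
      x.L246 + x.p4 * x.t2 * x.L246) * h4 + (2 * x.p2 * x.t1 * x.L136 + 4 * x.p4 * x.t1 * x.L245 + 2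
      * x.u * x.L136 + 2 * x.v * x.L245 + 2 * x.s3) * h5 + (2 * x.p4 * x.t1 * x.L246 + 2 * x.u *
      x.L245 + 2 * x.v * x.L246) * h6
  · linear_combination (-x.p1 * x.t2 * x.L135 - x.p3 * x.t2 * x.L136 - 2 * x.p4 * x.t2 * x.L125 +
      2 * x.v * x.t1 * x.L136) * h1 + (-x.p1 * x.t2 * x.L136 + 2 * x.p2 * x.t1 * x.L123 - x.p3 *
      x.t2 * x.L245 + 2 * x.p4 * x.t1 * x.L124 - 2 * x.p4 * x.t2 * x.L126 - 2 * x.u * x.t1 * x.L136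
      + 2 * x.u * x.L123 + 2 * x.v * x.L124 + 2 * x.t1 * x.s3 - x.t2 * x.s2) * h2 + (2 * x.p1 * x.t1
      * x.L135 - x.p2 * x.t2 * x.L135 + 2 * x.p3 * x.L123 + 2 * x.p4 * x.t1 * x.L125 - x.p4 * x.t2 *
      x.L136) * h3 + (4 * x.p1 * x.t1 * x.L136 - 2 * x.p2 * x.t1 * x.L125 - x.p2 * x.t2 * x.L136 + 2
      * x.p3 * x.t1 * x.L245 + 2 * x.p3 * x.L124 - x.p4 * x.t2 * x.L245 - 2 * x.u * x.L125 - 2 * x.v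
      * x.L126 - x.t2 * x.s1) * h4 + (-2 * x.p2 * x.t1 * x.L135 - 4 * x.p4 * x.t1 * x.L136 - 2 * x.u
      * x.L135 - 2 * x.v * x.L136) * h5 + (-2 * x.p4 * x.t1 * x.L245 - 2 * x.u * x.L136 - 2 * x.v *
      x.L245 + 2 * x.s3) * h6

/-- If `α` and `β` generate the unit ideal of `A`, a zero of `G` lifts to a zero of all `F`. -/
lemma F_solve_eq_zero {x : BaseTuple R} {w : Fin 6 → R} (hw : (M x).mulVec w = ![1, 0, 0])
    (hG : G x = 0) (h2 : IsUnit (2 : R)) (i : Fin 9) :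
    F ⟨x, solve x w (rhs x) 0, solve x w (rhs x) 1, solve x w (rhs x) 2⟩ i = 0 := by
  set y : PiTuple R := ⟨x, solve x w (rhs x) 0, solve x w (rhs x) 1, solve x w (rhs x) 2⟩ with hy
  have hs : ![y.s1, y.s2, y.s3] = solve x w (rhs x) := by
    funext r
    fin_cases r <;> rfl
  have hlin := vecMul_M_sub_rhs y
  rw [hs] at hlin
  change Matrix.vecMul _ (M x) - rhs x = _ at hlin
  rw [vecMul_solve_rhs hw hG, sub_self] at hlin
  have f1 : F1 y = 0 := (congrFun hlin 0).symm
  have f2 : F2 y = 0 := (congrFun hlin 1).symm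
  have f3 : F3 y = 0 := (congrFun hlin 2).symm
  have f4 : F4 y = 0 := (congrFun hlin 3).symm
  have f5 : F5 y = 0 := by
    have h : 0 = F5 y + y.t1 * F1 y := congrFun hlin 4
    rw [f1] at h
    linear_combination -h
  have f6 : F6 y = 0 := by
    have h : 0 = F6 y + y.t1 * F2 y := congrFun hlin 5
    rw [f2] at h
    linear_combination -h
  have hq : ![F7 y, F8 y, 2 * F9 y + y.t1 * F7 y] = 0 := by
    have h := smul_eq_solve (s := ![F7 y, F8 y, 2 * F9 y + y.t1 * F7 y]) hw
    have hz : Matrix.vecMul ![F7 y, F8 y, 2 * F9 y + y.t1 * F7 y] (M x) = 0 :=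
      vecMul_quadrics f1 f2 f3 f4 f5 f6
    rw [one_smul, hz] at h
    rw [h]
    funext r
    fin_cases r <;> simp [solve]
  have f7 : F7 y = 0 := congrFun hq 0
  have f8 : F8 y = 0 := congrFun hq 1
  have f9 : F9 y = 0 := by
    have h : 2 * F9 y + y.t1 * F7 y = 0 := congrFun hq 2
    rw [f7, mul_zero, add_zero] at h
    exact h2.mul_left_cancel (h.trans (mul_zero 2).symm)
  fin_cases i
  exacts [f1, f2, f3, f4, f5, f6, f7, f8, f9]

/-- The first column of the adjugate of the submatrix of `M` on the columns `i, j, k`, placed on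
these columns. -/
def cramerVec (x : BaseTuple R) (i j k : Fin 6) : Fin 6 → R := fun c =>
  ∑ q : Fin 3, if ![i, j, k] q = c then ((M x).submatrix id ![i, j, k]).adjugate q 0 else 0

lemma M_mulVec_cramerVec (x : BaseTuple R) (i j k : Fin 6) :
    (M x).mulVec (cramerVec x i j k) = ![D x i j k, 0, 0] := by
  have h := Matrix.mul_adjugate ((M x).submatrix id ![i, j, k])
  have key : ∀ r, (M x).mulVec (cramerVec x i j k) r =
      (((M x).submatrix id ![i, j, k]) * ((M x).submatrix id ![i, j, k]).adjugate) r 0 := by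
    intro r
    simp only [Matrix.mulVec, dotProduct, cramerVec, Finset.mul_sum, Matrix.mul_apply]
    rw [Finset.sum_comm]
    refine Finset.sum_congr rfl fun q _ => ?_
    simp
  funext r
  rw [key, h]
  fin_cases r <;> simp [D]

lemma thetaVec_map (φ : R →+* S) (x : BaseTuple R) (w : Fin 6 → R) :
    thetaVec (x.map φ) (φ ∘ w) = φ ∘ thetaVec x w := by
  funext i
  fin_cases i <;> simp [thetaVec, BaseTuple.map]

lemma solve_map (φ : R →+* S) (x : BaseTuple R) (w b : Fin 6 → R) :
    solve (x.map φ) (φ ∘ w) (φ ∘ b) = φ ∘ solve x w b := by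
  funext i
  fin_cases i <;> simp [solve, thetaVec_map, dotProduct]

lemma cramerVec_map (φ : R →+* S) (x : BaseTuple R) (i j k : Fin 6) :
    cramerVec (x.map φ) i j k = φ ∘ cramerVec x i j k := by
  funext c
  have h : (M (x.map φ)).submatrix id ![i, j, k] = φ.mapMatrix ((M x).submatrix id ![i, j, k]) := by
    rw [M_map]
    rfl
  simp only [cramerVec, h, ← RingHom.map_adjugate, Function.comp_apply, map_sum]
  refine Finset.sum_congr rfl fun q _ => ?_
  split_ifs <;> simp

end Identities

/-! ### Projections between projective spectra -/

section ProjGeneral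

universe u

variable {A B σ τ : Type u} [CommRing A] [SetLike σ A] [AddSubgroupClass σ A]
  [CommRing B] [SetLike τ B] [AddSubgroupClass τ B]
  {𝒜 : ℕ → σ} {ℬ : ℕ → τ} [GradedRing 𝒜] [GradedRing ℬ] (φ : 𝒜 →+*ᵍ ℬ)

/-- A graded homomorphism that becomes an isomorphism after inverting the homogeneous element `f`
induces an isomorphism of the degree zero parts of the localizations. -/
lemma bijective_awayMap {n : ℕ} {f : A} (hf : f ∈ 𝒜 n)
    (hinj : ∀ a, φ a = 0 → ∃ N : ℕ, f ^ N * a = 0)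
    (hsurj : ∀ b, ∃ (N : ℕ) (a : A), φ a = φ f ^ N * b) :
    Function.Bijective (Away.map φ f) := by
  constructor
  · rw [injective_iff_map_eq_zero]
    intro x hx
    obtain ⟨k, a, ha, rfl⟩ := Away.mk_surjective 𝒜 hf x
    have hx' := congrArg HomogeneousLocalization.val ((Away.map_mk φ f hf k a ha).symm.trans hx)
    rw [Away.val_mk, HomogeneousLocalization.val_zero, Localization.mk_eq_mk',
      IsLocalization.mk'_eq_zero_iff] at hx'
    obtain ⟨⟨_, l, rfl⟩, hl⟩ := hx'
    simp only [← map_pow, ← map_mul] at hl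
    obtain ⟨N, hN⟩ := hinj _ hl
    apply HomogeneousLocalization.val_injective
    rw [Away.val_mk, HomogeneousLocalization.val_zero, Localization.mk_eq_mk',
      IsLocalization.mk'_eq_zero_iff]
    exact ⟨⟨f ^ (N + l), N + l, rfl⟩, by
      change f ^ (N + l) * a = 0
      rw [← hN, ← mul_assoc, pow_add]⟩
  · intro y
    obtain ⟨k, b, hb, rfl⟩ := Away.mk_surjective ℬ (φ.2 hf) y
    obtain ⟨N, a, ha⟩ := hsurj b
    have hdeg : φ a ∈ ℬ ((N + k) • n) := by
      rw [ha, add_smul]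
      exact SetLike.mul_mem_graded (SetLike.pow_mem_graded N (φ.2 hf)) hb
    -- the homogeneous component of `a` of the right degree has the same image
    have hφ : φ (DirectSum.decompose 𝒜 a ((N + k) • n)) = φ f ^ N * b := by
      rw [GradedRingHom.map_directSumDecompose, DirectSum.decompose_of_mem_same _ hdeg, ha]
    refine ⟨Away.mk 𝒜 hf (N + k) (DirectSum.decompose 𝒜 a ((N + k) • n)) (SetLike.coe_mem _), ?_⟩
    rw [Away.map_mk]
    apply HomogeneousLocalization.val_injective
    rw [Away.val_mk, Away.val_mk, Localization.mk_eq_mk', IsLocalization.mk'_eq_iff_eq]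
    congr 1
    change φ f ^ k * φ _ = φ f ^ (N + k) * b
    rw [hφ]
    ring

lemma isOpenImmersion_projPiece {n : ℕ} {f : A} (hf : f ∈ 𝒜 n) (hn : 0 < n)
    (h : Function.Bijective (Away.map φ f)) :
    ∃ _ : IsOpenImmersion (projPiece φ f hf hn),
      (projPiece φ f hf hn).opensRange = Proj.basicOpen 𝒜 f := by
  have : IsIso (Proj.basicOpenToSpec ℬ (φ f)) := by
    rw [← Proj.basicOpenIsoSpec_hom ℬ (φ f) (φ.2 hf) hn]
    infer_instance
  have : IsIso (CommRingCat.ofHom (Away.map φ f : Away 𝒜 f →+* Away ℬ (φ f))) :=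
    (ConcreteCategory.isIso_iff_bijective _).2 h
  have : IsOpenImmersion (projPiece φ f hf hn) := by
    rw [projPiece]
    infer_instance
  refine ⟨this, ?_⟩
  rw [← Proj.opensRange_awayι 𝒜 f hf hn]
  unfold projPiece
  simp only [Scheme.Hom.opensRange_comp_of_isIso]

lemma exists_projection_restrict {n : ℕ} {f : A} (hf : f ∈ 𝒜 n) (hn : 0 < n) :
    ∃ h : Proj.basicOpen ℬ (φ f) ≤ projDomain φ,
      (Proj ℬ).homOfLE h ≫ projection φ = projPiece φ f hf hn :=
  ⟨_, projection_restrict φ ⟨⟨n, hn⟩, ⟨f, hf⟩⟩⟩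

/-- In `Proj` of a graded ring, `D₊(f)` is dense if `f` is a homogeneous nonzerodivisor. -/
lemma dense_basicOpen {f : A} (hreg : ∀ a, f * a = 0 → a = 0) :
    Dense (Proj.basicOpen 𝒜 f : Set (Proj 𝒜)) := by
  rw [dense_iff_inter_open]
  rintro U hU ⟨x, hx⟩
  obtain ⟨_, ⟨_, ⟨g, rfl⟩, rfl⟩, hxg, hgU⟩ :=
    (Proj.isBasis_basicOpen 𝒜).exists_subset_of_mem_open hx hU
  -- a homogeneous element of positive degree outside the prime ideal of `x`
  obtain ⟨d, hd, e, he, hxe⟩ : ∃ d, 0 < d ∧ ∃ e ∈ 𝒜 d, e ∉ x.asHomogeneousIdeal := by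
    by_contra! H
    refine x.not_irrelevant_le ?_
    refine (HomogeneousIdeal.toIdeal_irrelevant_le 𝒜).2 ?_
    intro i hi a ha
    exact H i hi a ha
  have hge : g * e ∉ x.asHomogeneousIdeal := fun h =>
    (x.isPrime.mem_or_mem h).elim hxg hxe
  have hnil : ¬ IsNilpotent (f * (g * e)) := by
    rintro ⟨k, hk⟩
    have hpow : ∀ (j : ℕ) (a : A), f ^ j * a = 0 → a = 0 := by
      intro j
      induction j with
      | zero => intro a h; simpa using h
      | succ j ih => intro a h; exact hreg _ (ih _ (by rw [← h]; ring))
    rw [mul_pow] at hk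
    have h0 := hpow _ _ hk
    exact hge (x.isPrime.mem_of_pow_mem k (h0 ▸ zero_mem _))
  obtain ⟨P, hP, hfP⟩ : ∃ P : Ideal A, P.IsPrime ∧ f * (g * e) ∉ P := by
    by_contra! H
    rw [← mem_nilradical, nilradical_eq_sInf, Ideal.mem_sInf] at hnil
    exact hnil fun {P} hP => H P hP
  have hle : (P.homogeneousCore 𝒜).toIdeal ≤ P := Ideal.toIdeal_homogeneousCore_le 𝒜 P
  have hf : f * (g * e) ∉ (P.homogeneousCore 𝒜).toIdeal := fun h => hfP (hle h)
  let y : Proj 𝒜 := ⟨P.homogeneousCore 𝒜, hP.homogeneousCore, fun h =>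
    hf (Ideal.mul_mem_left _ _ (Ideal.mul_mem_left _ _
      (h (HomogeneousIdeal.mem_irrelevant_of_mem 𝒜 hd he))))⟩
  refine ⟨y, hgU ?_, ?_⟩
  · change g ∉ (P.homogeneousCore 𝒜).toIdeal
    exact fun h => hf (Ideal.mul_mem_left _ _ (Ideal.mul_mem_right _ _ h))
  · change f ∉ (P.homogeneousCore 𝒜).toIdeal
    exact fun h => hf (Ideal.mul_mem_right _ _ h)

/-- If `φ` becomes an isomorphism after inverting a homogeneous `f` of positive degree that is a
nonzerodivisor on both sides, then the induced projection is birational. -/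
lemma isBirationalMap_projection {n : ℕ} {f : A} (hf : f ∈ 𝒜 n) (hn : 0 < n)
    (h : Function.Bijective (Away.map φ f)) (hA : ∀ a, f * a = 0 → a = 0)
    (hB : ∀ b, φ f * b = 0 → b = 0) : IsBirationalMap (projection φ) := by
  obtain ⟨hle, hpr⟩ := exists_projection_restrict φ hf hn
  obtain ⟨hi, hr⟩ := isOpenImmersion_projPiece φ hf hn h
  have hrange : Set.range (projPiece φ f hf hn) = Set.range (Proj.basicOpen 𝒜 f).ι := by
    rw [Scheme.Opens.range_ι]
    exact congrArg (fun V : (Proj 𝒜).Opens => (V : Set (Proj 𝒜))) hr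
  refine ⟨⟨Proj.basicOpen ℬ (φ f), dense_basicOpen hB, Proj.basicOpen 𝒜 f, dense_basicOpen hA,
    IsOpenImmersion.isoOfRangeEq (projPiece φ f hf hn) (Proj.basicOpen 𝒜 f).ι hrange⟩, hle, ?_⟩
  rw [hpr]
  exact IsOpenImmersion.isoOfRangeEq_hom_fac _ _ hrange

/-- If `φ` becomes an isomorphism after inverting a homogeneous `f` of positive degree, then the
exceptional locus of the projection does not meet `D₊(φ f)`. -/
lemma notMem_exceptionalLocus {n : ℕ} {f : A} (hf : f ∈ 𝒜 n) (hn : 0 < n)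
    (h : Function.Bijective (Away.map φ f)) {x : Proj ℬ} (hx : x ∈ Proj.basicOpen ℬ (φ f)) :
    x ∉ exceptionalLocus (projection φ) := by
  obtain ⟨hle, hpr⟩ := exists_projection_restrict φ hf hn
  refine fun hex => hex ⟨_, hle, hx, ?_⟩
  rw [hpr]
  exact (isOpenImmersion_projPiece φ hf hn h).choose

end ProjGeneral

/-! ### The isomorphism over the nonvanishing of a minor -/

section Minors

variable (W : Weights) (m : ℕ)

/-- The class of the minor `D_{ijk}` in the homogeneous coordinate ring of the hypersurface. -/
noncomputable def hypMinor (i j k : Fin 6) : HypRing W m :=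
  Ideal.Quotient.mk _ (D (hypGen m) i j k)

/-- The base coordinates in the coordinate ring of the hypersurface. -/
noncomputable def hypTuple : BaseTuple (HypRing W m) := (hypGen m).map (Ideal.Quotient.mk _)

/-- The coordinates in the coordinate ring of the key variety. -/
noncomputable def piTuple : PiTuple (PiRing W m) := (piGen m).map (Ideal.Quotient.mk _)

lemma D_hypTuple (i j k : Fin 6) : D (hypTuple W m) i j k = hypMinor W m i j k := D_map _ _ _ _ _

lemma D_piTuple (i j k : Fin 6) : D (piTuple W m).toBaseTuple i j k = minor W m i j k :=
  D_map (Ideal.Quotient.mk _) (piGen m).toBaseTuple i j k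

lemma G_hypTuple : G (hypTuple W m) = 0 := by
  rw [hypTuple, G_map]
  exact Ideal.Quotient.eq_zero_iff_mem.2 (Ideal.subset_span rfl)

lemma F_piTuple (i : Fin 9) : F (piTuple W m) i = 0 := by
  rw [piTuple, F_map]
  exact Ideal.Quotient.eq_zero_iff_mem.2 (Ideal.subset_span ⟨i, rfl⟩)

lemma coordHom_mk (f : HypPoly m) :
    coordHom W m (Ideal.Quotient.mk _ f) = Ideal.Quotient.mk _ (MvPolynomial.rename Sum.inl f) :=
  rfl

lemma coordHom_coord (i : HypVar m) :
    coordHom W m (Ideal.Quotient.mk _ (MvPolynomial.X i)) = coord W m (.inl i) := by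
  rw [coordHom_mk, MvPolynomial.rename_X]
  rfl

lemma hypTuple_map_coordHom :
    (hypTuple W m).map (coordHom W m).toRingHom = (piTuple W m).toBaseTuple := by
  simp only [hypTuple, piTuple, hypGen, piGen, PiTuple.map, BaseTuple.map, BaseTuple.ofFun,
    GradedRingHom.coe_toRingHom, coordHom_mk, MvPolynomial.rename_X, map_one]

lemma coordHom_hypMinor (i j k : Fin 6) :
    coordHom W m (hypMinor W m i j k) = minor W m i j k := by
  rw [← D_hypTuple, ← D_piTuple, ← hypTuple_map_coordHom, D_map]
  rfl

lemma isUnit_two {Q : Type*} [CommRing Q] (χ : HypRing W m →+* Q) : IsUnit (2 : Q) := by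
  have h : IsUnit (2 : ℂ) := by norm_num
  have h' := h.map (χ.comp (algebraMap ℂ (HypRing W m)))
  rwa [map_ofNat] at h'

/-- A homomorphism out of the coordinate ring of the hypersurface that makes a minor invertible
extends to the coordinate ring of the key variety. -/
lemma exists_extension {Q : Type*} [CommRing Q] (χ₀ : HypRing W m →+* Q) {i j k : Fin 6}
    (hu : IsUnit (χ₀ (hypMinor W m i j k))) :
    ∃ χ : PiRing W m →+* Q, ∀ a, χ (coordHom W m a) = χ₀ a := by
  obtain ⟨d, hd⟩ := hu
  set x : BaseTuple Q := (hypTuple W m).map χ₀ with hx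
  have hG : G x = 0 := by rw [hx, G_map, G_hypTuple, map_zero]
  have hw : (M x).mulVec ((↑d⁻¹ : Q) • cramerVec x i j k) = ![1, 0, 0] := by
    rw [Matrix.mulVec_smul, M_mulVec_cramerVec, hx, D_map, D_hypTuple, ← hd]
    simp
  have hF := F_solve_eq_zero hw hG (isUnit_two W m χ₀)
  set y : PiTuple Q := _ with hy
  change ∀ i, F y i = 0 at hF
  let χ' : PiPoly m →+* Q := MvPolynomial.eval₂Hom (χ₀.comp (algebraMap ℂ (HypRing W m)))
    (Sum.elim (fun l => χ₀ (Ideal.Quotient.mk _ (MvPolynomial.X l))) ![y.s1, y.s2, y.s3])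
  have hχ' : (piGen m).map χ' = y := by
    simp only [hy, hx, hypTuple, hypGen, piGen, PiTuple.map, BaseTuple.map, BaseTuple.ofFun, χ',
      map_one, MvPolynomial.eval₂Hom_X', Sum.elim_inl, Sum.elim_inr]
    rfl
  have hker : ∀ a ∈ (piIdeal W m).toIdeal, χ' a = 0 := by
    have : (piIdeal W m).toIdeal ≤ RingHom.ker χ' := by
      refine Ideal.span_le.2 ?_
      rintro _ ⟨l, rfl⟩
      change χ' (F (piGen m) l) = 0
      rw [← F_map, hχ', hF]
    exact this
  refine ⟨Ideal.Quotient.lift _ χ' hker, fun a => ?_⟩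
  obtain ⟨f, rfl⟩ := Ideal.Quotient.mk_surjective a
  rw [coordHom_mk, Ideal.Quotient.lift_mk]
  have : χ'.comp (MvPolynomial.rename (R := ℂ) (Sum.inl : HypVar m → PiVar m)).toRingHom =
      χ₀.comp (Ideal.Quotient.mk _) := by
    refine MvPolynomial.ringHom_ext (fun c => ?_) fun l => ?_
    · simp [χ']
      rfl
    · simp [χ']
  exact congrArg (fun h : HypPoly m →+* Q => h f) this

lemma exists_minor_pow_mul_eq_zero (i j k : Fin 6) {a : HypRing W m} (ha : coordHom W m a = 0) :
    ∃ N : ℕ, hypMinor W m i j k ^ N * a = 0 := by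
  obtain ⟨χ, hχ⟩ := exists_extension W m
    (algebraMap (HypRing W m) (Localization.Away (hypMinor W m i j k)))
    (IsLocalization.Away.algebraMap_isUnit (hypMinor W m i j k))
  have h := hχ a
  rw [ha, map_zero] at h
  obtain ⟨⟨_, N, rfl⟩, hN⟩ := (IsLocalization.map_eq_zero_iff
    (Submonoid.powers (hypMinor W m i j k)) _ a).1 h.symm
  exact ⟨N, hN⟩

lemma exists_coordHom_eq_minor_mul_coord (i j k : Fin 6) (r : Fin 3) :
    ∃ a, coordHom W m a = minor W m i j k * coord W m (.inr r) := by
  have h := smul_eq_solve (s := ![(piTuple W m).s1, (piTuple W m).s2, (piTuple W m).s3])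
    (M_mulVec_cramerVec (piTuple W m).toBaseTuple i j k)
  rw [vecMul_M_eq_rhs (F_piTuple W m), D_piTuple, ← hypTuple_map_coordHom, cramerVec_map,
    rhs_map, solve_map] at h
  have hr := congrFun h r
  refine ⟨_, hr.symm.trans ?_⟩
  fin_cases r <;> rfl

lemma exists_coordHom_eq_minor_pow_mul (i j k : Fin 6) (b : PiRing W m) :
    ∃ (N : ℕ) (a : HypRing W m), coordHom W m a = minor W m i j k ^ N * b := by
  obtain ⟨p, rfl⟩ := Ideal.Quotient.mk_surjective b
  induction p using MvPolynomial.induction_on with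
  | C c =>
    refine ⟨0, Ideal.Quotient.mk _ (MvPolynomial.C c), ?_⟩
    rw [coordHom_mk, MvPolynomial.rename_C, pow_zero, one_mul]
  | add p q hp hq =>
    obtain ⟨N, a, ha⟩ := hp
    obtain ⟨N', a', ha'⟩ := hq
    refine ⟨N + N', hypMinor W m i j k ^ N' * a + hypMinor W m i j k ^ N * a', ?_⟩
    rw [map_add, map_mul, map_mul, map_pow, map_pow, coordHom_hypMinor, ha, ha', map_add]
    ring
  | mul_X p l hp =>
    obtain ⟨N, a, ha⟩ := hp
    rw [map_mul]
    change ∃ _ _, _ = _ * (_ * coord W m l)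
    rcases l with l | r
    · refine ⟨N, a * Ideal.Quotient.mk _ (MvPolynomial.X l), ?_⟩
      rw [map_mul, ha, coordHom_coord, mul_assoc]
    · obtain ⟨a', ha'⟩ := exists_coordHom_eq_minor_mul_coord W m i j k r
      refine ⟨N + 1, a * a', ?_⟩
      rw [map_mul, ha, ha']
      ring

/-- The entry of `M` in row `a` and column `l` is homogeneous of degree `e a + c l`, where
`e = (2δ, δ, 0)` with `δ` the weight of `θ`. So all six terms in the expansion of a minor have the
same degree. -/
lemma exists_D_mem {A : Type*} [CommRing A] [Algebra ℂ A] {𝒜 : ℕ → Submodule ℂ A}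
    [SetLike.GradedMonoid 𝒜] {x : PiTuple A} {w : PiTuple ℕ} {g : ℕ} (h : HomTuple 𝒜 x w)
    (r : WeightRel w g) (hpos : 0 < w.p1 ∧ 0 < w.p2 ∧ 0 < w.p3 ∧ 0 < w.p4 ∧ 0 < w.u ∧ 0 < w.v)
    (ht : 0 < w.t1) (i j k : Fin 6) : ∃ n, 0 < n ∧ D x.toBaseTuple i j k ∈ 𝒜 n := by
  obtain ⟨xp1, xp2, xp3, xp4, xu, xv, xt1, xt2, -⟩ := h
  obtain ⟨wp1, wp2, wp4, -, -, -, wt1, wt2, -⟩ := r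
  obtain ⟨δ, hδ⟩ : ∃ δ : ℕ, w.v = w.p3 + δ := ⟨w.v - w.p3, by omega⟩
  let c : Fin 6 → ℕ := ![w.p2, w.p4, w.p1, w.p3, w.u, w.v]
  let e : Fin 3 → ℕ := ![2 * δ, δ, 0]
  have hc : ∀ l, 0 < c l := by
    intro l
    fin_cases l <;> simp [c] <;> omega
  have hM : ∀ a l, M x.toBaseTuple a l ∈ 𝒜 (e a + c l) := by
    have s : ∀ {i j : ℕ} {a : A}, a ∈ 𝒜 i → i = j → a ∈ 𝒜 j := fun h e => e ▸ h
    intro a l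
    fin_cases a <;> fin_cases l <;> simp [M, e, c]
    · exact s xu (by omega)
    · exact s xv (by omega)
    · exact hmul xt2 xp2 (by omega)
    · exact hmul xt2 xp4 (by omega)
    · exact add_mem (neg_mem (hmul xt2 xp1 (by omega))) (hmul xt1 xu (by omega))
    · exact add_mem (neg_mem (hmul xt2 xp3 (by omega))) (hmul xt1 xv (by omega))
    · exact s xp1 (by omega)
    · exact s xp3 (by omega)
    · exact add_mem (s xu (by omega)) (hmul xt1 xp2 (by omega))
    · exact add_mem (s xv (by omega)) (hmul xt1 xp4 (by omega))
    · exact hmul xt2 xp2 (by omega)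
    · exact hmul xt2 xp4 (by omega)
    · exact xp2
    · exact xp4
    · exact xp1
    · exact xp3
    · exact xu
    · exact xv
  refine ⟨c i + c j + c k + 3 * δ, by have := hc i; omega, ?_⟩
  rw [D, Matrix.det_fin_three]
  simp only [Matrix.submatrix_apply, id]
  refine sub_mem (add_mem (add_mem (sub_mem (sub_mem ?_ ?_) ?_) ?_) ?_) ?_
  all_goals
    refine hmul (hmul (hM _ _) (hM _ _) rfl) (hM _ _) ?_
    simp [e]
    ring

lemma exists_hypMinor_mem (i j k : Fin 6) :
    ∃ n, 0 < n ∧ hypMinor W m i j k ∈ hypGrading W m n := by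
  obtain ⟨n, hn, h⟩ := exists_D_mem (homTuple_hypGen W m) W.rel
    ⟨W.get_pos .p1, W.get_pos .p2, W.get_pos .p3, W.get_pos .p4, W.get_pos .u, W.get_pos .v⟩
    (W.get_pos .t1) i j k
  exact ⟨n, hn, mk_mem_quotGrading _ _ h⟩

/-- Over `D₊(D_{ijk})` the projection is an isomorphism: there the linear equations determine
`s1, s2, s3`, they are compatible on `G = 0`, and the quadratic equations follow. -/
lemma bijective_awayMap_hypMinor (i j k : Fin 6) :
    Function.Bijective (Away.map (coordHom W m) (hypMinor W m i j k)) := by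
  obtain ⟨n, -, hmem⟩ := exists_hypMinor_mem W m i j k
  refine bijective_awayMap (coordHom W m) hmem
    (fun a ha => exists_minor_pow_mul_eq_zero W m i j k ha) fun b => ?_
  rw [coordHom_hypMinor]
  exact exists_coordHom_eq_minor_pow_mul W m i j k b

lemma exceptionalLocus_subset_minorLocus :
    exceptionalLocus (piProjection W m) ⊆ minorLocus W m := by
  rintro x hx _ ⟨i, j, k, -, -, rfl⟩ hxm
  obtain ⟨n, hn, hmem⟩ := exists_hypMinor_mem W m i j k
  rw [← coordHom_hypMinor] at hxm
  exact notMem_exceptionalLocus (coordHom W m) hmem hn (bijective_awayMap_hypMinor W m i j k)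
    hxm hx

lemma isClosed_minorLocus : IsClosed (minorLocus W m) := by
  have : minorLocus W m = ⋂ f ∈ {f | ∃ i j k : Fin 6, i < j ∧ j < k ∧ f = minor W m i j k},
      ((Proj.basicOpen (piGrading W m) f : Set (PiP W m)))ᶜ := by
    ext x
    simp [minorLocus, vanishing]
  rw [this]
  exact isClosed_biInter fun f _ => (Proj.basicOpen (piGrading W m) f).isOpen.isClosed_compl

end Minors

/-! ### Embeddings from spanning and linearly independent families -/

section LinearAlgebra

/-- Over a domain, a family that is congruent to part of a basis modulo a proper ideal is linearly
independent. -/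
lemma linearIndependent_of_sub_mem {R B ι κ : Type*} [CommRing R] [IsDomain R] [AddCommGroup B]
    [Module R B] (b : Module.Basis ι R B) {𝔪 : Ideal R} (h𝔪 : 𝔪 ≠ ⊤) {w : κ → B} {e : κ → ι}
    (he : Function.Injective e) (h : ∀ k, w k - b (e k) ∈ 𝔪 • (⊤ : Submodule R B)) :
    LinearIndependent R w := by
  classical
  rw [linearIndependent_iff']
  intro s c hc
  set J : Ideal R := Ideal.span (s.image c) with hJ
  have hcoord : ∀ x ∈ 𝔪 • (⊤ : Submodule R B), ∀ i, b.coord i x ∈ 𝔪 := by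
    intro x hx i
    refine Submodule.smul_induction_on hx (fun r hr y _ => ?_) fun y z hy hz => ?_
    · rw [map_smul, smul_eq_mul]
      exact Ideal.mul_mem_right _ _ hr
    · rw [map_add]
      exact add_mem hy hz
  have hcJ : ∀ k ∈ s, c k ∈ J := fun k hk => Ideal.subset_span (by
    simpa using ⟨k, hk, rfl⟩)
  -- the coefficients of the relation generate an ideal `J` with `J = 𝔪 J`
  have hle : J ≤ 𝔪 • J := by
    refine Ideal.span_le.2 ?_
    intro _ hck
    obtain ⟨k, hk, rfl⟩ := Finset.mem_image.1 (Finset.mem_coe.1 hck)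
    have h0 := congrArg (b.coord (e k)) hc
    have h1 : c k = -∑ l ∈ s, c l * b.coord (e k) (w l - b (e l)) := by
      have h2 : ∑ l ∈ s, c l * b.coord (e k) (b (e l)) = c k := by
        rw [Finset.sum_eq_single_of_mem k hk]
        · simp
        · intro l _ hl
          simp [he.ne hl]
      rw [map_zero, map_sum] at h0
      simp only [map_smul, smul_eq_mul] at h0
      simp only [map_sub, mul_sub, Finset.sum_sub_distrib, h0, h2]
      ring
    rw [h1]
    refine neg_mem (sum_mem fun l hl => ?_)
    rw [mul_comm]
    exact Submodule.smul_mem_smul (hcoord _ (h l) _) (hcJ l hl)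
  obtain ⟨r, hr, hrJ⟩ := Submodule.exists_sub_one_mem_and_smul_eq_zero_of_fg_of_le_smul 𝔪 J
    ⟨s.image c, rfl⟩ hle
  intro k hk
  refine (mul_eq_zero.1 (hrJ _ (hcJ k hk))).resolve_left ?_
  rintro rfl
  exact h𝔪 ((Ideal.eq_top_iff_one _).2 (by simpa using neg_mem hr))

open Polynomial in
/-- If `A` is spanned over `S[x]` by the `E i`, and the images in `B` of the products of powers of
`x` with the `E i` are linearly independent over a ring containing `S`, then `A` embeds in `B`. -/
lemma injective_of_span_of_linearIndependent {S R A B κ : Type*} [CommRing S] [CommRing R]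
    [CommRing A] [CommRing B] [Fintype κ] [Algebra R B] (j : S →+* A) (x : A) (E : κ → A)
    (hspan : ∀ a, ∃ P : κ → S[X], a = ∑ i, eval₂ j x (P i) * E i) (ψ : A →+* B) (ι : S →+* R)
    (hι : Function.Injective ι) (hcomp : ∀ s, ψ (j s) = algebraMap R B (ι s))
    (hli : LinearIndependent R fun q : ℕ × κ => ψ x ^ q.1 * ψ (E q.2)) :
    Function.Injective ψ := by
  rw [injective_iff_map_eq_zero]
  intro a ha
  obtain ⟨P, rfl⟩ := hspan a
  set N := ∑ i, ((P i).natDegree + 1) with hN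
  have hdeg : ∀ i, (P i).natDegree < N := fun i =>
    (Nat.lt_succ_self _).trans_le
      (Finset.single_le_sum (f := fun i => (P i).natDegree + 1) (fun _ _ => Nat.zero_le _)
        (Finset.mem_univ i))
  rw [linearIndependent_iff'] at hli
  have h := hli (Finset.range N ×ˢ Finset.univ) (fun q => ι ((P q.2).coeff q.1)) (by
    rw [← ha, Finset.sum_product_right, map_sum]
    refine Finset.sum_congr rfl fun i _ => ?_
    rw [map_mul, eval₂_eq_sum_range' j (hdeg i), map_sum, Finset.sum_mul]
    refine Finset.sum_congr rfl fun k _ => ?_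
    rw [Algebra.smul_def, map_mul, map_pow, hcomp, mul_assoc])
  have hP : ∀ i, P i = 0 := by
    intro i
    ext k
    rw [coeff_zero]
    by_cases hk : k < N
    · exact hι ((h (k, i) (by simpa using hk)).trans (map_zero ι).symm)
    · exact coeff_eq_zero_of_natDegree_lt ((hdeg i).trans_le (not_lt.1 hk))
  simp [hP]

end LinearAlgebra

/-! ### Spanning families of the coordinate rings -/

section Parameters

/-- The base coordinates other than `p3` and `v`. Together with `s1` these are parameters for the
key variety, and together with `p3` they are parameters for the hypersurface. -/
inductive ParamVar : Type
  | p1 | p2 | p4 | u | t1 | t2 | L123 | L124 | L125 | L126 | L135 | L136 | L245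

/-- A parameter as a base coordinate. -/
def ParamVar.toBase : ParamVar → BaseVar
  | .p1 => .p1 | .p2 => .p2 | .p4 => .p4 | .u => .u | .t1 => .t1 | .t2 => .t2
  | .L123 => .L123 | .L124 => .L124 | .L125 => .L125 | .L126 => .L126
  | .L135 => .L135 | .L136 => .L136 | .L245 => .L245

/-- The values of the base coordinates given by those of the parameters, of `p3` and of `v`. -/
def BaseVar.ofParam {Q : Type*} (g : ParamVar → Q) (p3 v : Q) : BaseVar → Q
  | .p1 => g .p1 | .p2 => g .p2 | .p3 => p3 | .p4 => g .p4 | .u => g .u | .v => v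
  | .t1 => g .t1 | .t2 => g .t2 | .L123 => g .L123 | .L124 => g .L124 | .L125 => g .L125
  | .L126 => g .L126 | .L135 => g .L135 | .L136 => g .L136 | .L245 => g .L245

/-- The tuple with `L246 = 1` and the given values of the parameters, of `p3` and of `v`. -/
def paramTuple {Q : Type*} [One Q] (g : ParamVar → Q) (p3 v : Q) : BaseTuple Q :=
  .ofFun (BaseVar.ofParam g p3 v)

lemma paramTuple_map {Q Q' : Type*} [CommRing Q] [CommRing Q'] (φ : Q →+* Q') (g : ParamVar → Q)
    (p3 v : Q) : (paramTuple g p3 v).map φ = paramTuple (fun b => φ (g b)) (φ p3) (φ v) := by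
  simp [paramTuple, BaseTuple.map, BaseTuple.ofFun, BaseVar.ofParam]

/-- The minor `D_{135}` is the norm of `α`, so it depends on the parameters only. -/
lemma D_paramTuple {Q : Type*} [CommRing Q] (g : ParamVar → Q) (p3 v p3' v' : Q) :
    D (paramTuple g p3 v) 0 2 4 = D (paramTuple g p3' v') 0 2 4 := by
  simp [D, M, Matrix.det_fin_three, paramTuple, BaseTuple.ofFun, BaseVar.ofParam]

/-- The coefficient of `v²` in `G`. -/
def cubicCoeffTwo {Q : Type*} [CommRing Q] (x : BaseTuple Q) : Q :=
  x.p1 * x.L126 + 2 * x.p2 * x.t1 * x.L245 - x.p2 * x.L124 + 2 * x.p4 * x.t1 * x.L246 + 3 *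
  x.u * x.L245

/-- The coefficient of `v` in `G`. -/
def cubicCoeffOne {Q : Type*} [CommRing Q] (x : BaseTuple Q) : Q :=
  x.p1 ^ 2 * x.t1 * x.L136 - x.p1 ^ 2 * x.L123 - 3 * x.p1 * x.p2 * x.t2 * x.L136 + 2 * x.p1 *
  x.p3 * x.t1 * x.L245 - x.p1 * x.p3 * x.L124 + x.p1 * x.p4 * x.t1 * x.L126 - 3 * x.p1 * x.p4
  * x.t2 * x.L245 + x.p1 * x.u * x.L125 + x.p2 ^ 2 * x.t1 ^ 2 * x.L136 - x.p2 ^ 2 * x.t1 *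
  x.L123 + x.p2 ^ 2 * x.t2 * x.L125 - x.p2 * x.p3 * x.t1 * x.L126 - 3 * x.p2 * x.p3 * x.t2 *
  x.L245 + 2 * x.p2 * x.p4 * x.t1 ^ 2 * x.L245 - x.p2 * x.p4 * x.t1 * x.L124 + x.p2 * x.p4 *
  x.t2 * x.L126 + 4 * x.p2 * x.u * x.t1 * x.L136 - x.p2 * x.u * x.L123 + x.p3 ^ 2 * x.t1 *
  x.L246 - 3 * x.p3 * x.p4 * x.t2 * x.L246 - x.p3 * x.u * x.L126 + x.p4 ^ 2 * x.t1 ^ 2 *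
  x.L246 + 4 * x.p4 * x.u * x.t1 * x.L245 + x.p4 * x.u * x.L124 + 3 * x.u ^ 2 * x.L136

/-- For `L246 = 1` the polynomial `G` is a monic cubic in `v`. -/
lemma G_paramTuple {Q : Type*} [CommRing Q] (g : ParamVar → Q) (p3 v : Q) :
    G (paramTuple g p3 v) = v ^ 3 + cubicCoeffTwo (paramTuple g p3 0) * v ^ 2
      + cubicCoeffOne (paramTuple g p3 0) * v + G (paramTuple g p3 0) := by
  simp [G, D, M, Matrix.det_fin_three, paramTuple, BaseTuple.ofFun, BaseVar.ofParam,
    cubicCoeffTwo, cubicCoeffOne]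
  ring

lemma cubicCoeffTwo_map {Q Q' : Type*} [CommRing Q] [CommRing Q'] (φ : Q →+* Q')
    (x : BaseTuple Q) : cubicCoeffTwo (x.map φ) = φ (cubicCoeffTwo x) := by
  have two : φ 2 = 2 := map_ofNat φ 2
  have three : φ 3 = 3 := map_ofNat φ 3
  simp [cubicCoeffTwo, BaseTuple.map, two, three]

lemma cubicCoeffOne_map {Q Q' : Type*} [CommRing Q] [CommRing Q'] (φ : Q →+* Q')
    (x : BaseTuple Q) : cubicCoeffOne (x.map φ) = φ (cubicCoeffOne x) := by
  have two : φ 2 = 2 := map_ofNat φ 2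
  have three : φ 3 = 3 := map_ofNat φ 3
  have four : φ 4 = 4 := map_ofNat φ 4
  simp [cubicCoeffOne, BaseTuple.map, two, three, four]

/-- Over the parameters and `p3`, the powers `1, v, v²` span a module stable under `v`. -/
lemma v_mul_mem_span {T A : Type*} [CommRing T] [CommRing A] [Algebra T A] (g : ParamVar → T)
    (p3 : T) (v : A)
    (hG : G (paramTuple (fun b => algebraMap T A (g b)) (algebraMap T A p3) v) = 0) {a : A}
    (ha : a ∈ Submodule.span T (Set.range fun b : Fin 3 => v ^ (b : ℕ))) :
    v * a ∈ Submodule.span T (Set.range fun b : Fin 3 => v ^ (b : ℕ)) := by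
  set N := Submodule.span T (Set.range fun b : Fin 3 => v ^ (b : ℕ)) with hN
  have h0 : (1 : A) ∈ N := Submodule.subset_span ⟨0, by simp⟩
  have h1 : v ∈ N := Submodule.subset_span ⟨1, by simp⟩
  have h2 : v ^ 2 ∈ N := Submodule.subset_span ⟨2, by simp⟩
  have h3 : v ^ 3 ∈ N := by
    have hz : paramTuple (fun b => algebraMap T A (g b)) (algebraMap T A p3) 0 =
        (paramTuple g p3 0).map (algebraMap T A) := by
      rw [paramTuple_map, map_zero]
    rw [G_paramTuple, hz, cubicCoeffTwo_map, cubicCoeffOne_map, G_map] at hG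
    have e : v ^ 3 = (-cubicCoeffTwo (paramTuple g p3 0)) • v ^ 2
        + (-cubicCoeffOne (paramTuple g p3 0)) • v + (-G (paramTuple g p3 0)) • (1 : A) := by
      simp only [Algebra.smul_def, map_neg]
      linear_combination hG
    rw [e]
    exact N.add_mem (N.add_mem (N.smul_mem _ h2) (N.smul_mem _ h1)) (N.smul_mem _ h0)
  refine (Submodule.span_le (p := N.comap (LinearMap.mulLeft T v))).2 ?_ ha
  rintro _ ⟨b, rfl⟩
  change v * v ^ (b : ℕ) ∈ N
  fin_cases b
  · simpa using h1
  · simpa [pow_two] using h2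
  · change v * v ^ 2 ∈ N
    rw [← pow_succ']
    exact h3

/-- The module generators `1, v, s3, p3, s2, v s2` of the coordinate ring of the key variety over
the parameters and `s1`. For `α = 1` and all other parameters zero they become `p3ᵃ vᵇ` with
`a < 2`, `b < 3`, and `s1` becomes `p3²`. -/
def piSpan {A : Type*} [CommRing A] (p3 v s2 s3 : A) : Fin 2 × Fin 3 → A :=
  fun q => ![![1, v, s3], ![p3, s2, v * s2]] q.1 q.2

lemma forall_F_eq_zero {Q : Type*} [CommRing Q] {x : PiTuple Q} (h : ∀ i, F x i = 0) :
    F1 x = 0 ∧ F2 x = 0 ∧ F3 x = 0 ∧ F4 x = 0 ∧ F5 x = 0 ∧ F6 x = 0 ∧ F7 x = 0 ∧ F8 x = 0 ∧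
      F9 x = 0 :=
  ⟨h 0, h 1, h 2, h 3, h 4, h 5, h 6, h 7, h 8⟩

set_option maxHeartbeats 2000000 in
/-- Nine of the ten quadratic monomials in `p3, v, s2, s3` are leading terms of the equations
`F1, …, F9`; the tenth is `v s2`. So `1, p3, v, s2, s3, v s2` span a module stable under
multiplication by `p3, v, s2, s3`. -/
lemma mul_mem_span_piSpan {T A : Type*} [CommRing T] [CommRing A] [Algebra T A]
    (g : ParamVar → T) (s1 : T) (p3 v s2 s3 : A)
    (hF : ∀ i, F ⟨paramTuple (fun b => algebraMap T A (g b)) p3 v, algebraMap T A s1, s2, s3⟩ i = 0)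
    {a : A} (ha : a ∈ Submodule.span T (Set.range (piSpan p3 v s2 s3))) :
    p3 * a ∈ Submodule.span T (Set.range (piSpan p3 v s2 s3)) ∧
    v * a ∈ Submodule.span T (Set.range (piSpan p3 v s2 s3)) ∧
    s2 * a ∈ Submodule.span T (Set.range (piSpan p3 v s2 s3)) ∧
    s3 * a ∈ Submodule.span T (Set.range (piSpan p3 v s2 s3)) := by
  set N := Submodule.span T (Set.range (piSpan p3 v s2 s3)) with hN
  set L := Submodule.span T {1, v, p3, s2, s3} with hL
  have h_one : (1 : A) ∈ L := Submodule.subset_span (by simp)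
  have hv : v ∈ L := Submodule.subset_span (by simp)
  have hp3 : p3 ∈ L := Submodule.subset_span (by simp)
  have hs2 : s2 ∈ L := Submodule.subset_span (by simp)
  have hs3 : s3 ∈ L := Submodule.subset_span (by simp)
  have v_s2 : v * s2 ∈ N := Submodule.subset_span ⟨(1, 2), rfl⟩
  have hLN : ∀ {x}, x ∈ L → x ∈ N := by
    intro x hx
    refine (Submodule.span_le (p := N)).2 ?_ hx
    rintro _ (rfl | rfl | rfl | rfl | rfl)
    exacts [Submodule.subset_span ⟨(0, 0), rfl⟩, Submodule.subset_span ⟨(0, 1), rfl⟩,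
      Submodule.subset_span ⟨(1, 0), rfl⟩, Submodule.subset_span ⟨(1, 1), rfl⟩,
      Submodule.subset_span ⟨(0, 2), rfl⟩]
  obtain ⟨h1, h2, h3, h4, h5, h6, h7, h8, h9⟩ := forall_F_eq_zero hF
  simp only [F1, paramTuple, BaseTuple.ofFun, BaseVar.ofParam] at h1
  simp only [F2, paramTuple, BaseTuple.ofFun, BaseVar.ofParam] at h2
  simp only [F3, paramTuple, BaseTuple.ofFun, BaseVar.ofParam] at h3
  simp only [F4, paramTuple, BaseTuple.ofFun, BaseVar.ofParam] at h4
  simp only [F5, paramTuple, BaseTuple.ofFun, BaseVar.ofParam] at h5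
  simp only [F6, paramTuple, BaseTuple.ofFun, BaseVar.ofParam] at h6
  simp only [F7, paramTuple, BaseTuple.ofFun, BaseVar.ofParam] at h7
  simp only [F8, paramTuple, BaseTuple.ofFun, BaseVar.ofParam] at h8
  simp only [F9, paramTuple, BaseTuple.ofFun, BaseVar.ofParam] at h9
  have p3_sq : p3 * p3 ∈ L := by
    have e : p3 * p3 = (-g .p1 ^ 2 * g .L136 - g .p1 * g .p4 * g .L126 - g .p2 ^ 2 * g .t1 * g
      .L136 - 2 * g .p2 * g .p4 * g .t1 * g .L245 - g .p2 * g .u * g .L136 - g .p4 ^ 2 * g .t1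
      - g .p4 * g .u * g .L245 + g .u * s1) • (1 : A) + (-g .p1) • (s2 : A) + (-g .p2) • (s3 :
      A) + (-2 * g .p1 * g .L245 + g .p2 * g .L126) • (p3 : A) + (-g .p2 * g .L245 - g .p4) •
      (v : A) := by
      simp only [Algebra.smul_def, map_add, map_sub, map_neg, map_mul, map_pow, map_ofNat]
      linear_combination (-1) * h1
    rw [e]
    exact L.add_mem (L.add_mem (L.add_mem (L.add_mem (L.smul_mem _ h_one) (L.smul_mem _ hs2))
      (L.smul_mem _ hs3)) (L.smul_mem _ hp3)) (L.smul_mem _ hv)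
  have v_p3 : v * p3 ∈ L := by
    have e : v * p3 = (-g .p1 * g .p4 * g .L124 - g .p1 * g .u * g .L136 - g .p2 ^ 2 * g .t2 *
      g .L136 - 2 * g .p2 * g .p4 * g .t2 * g .L245 - g .p2 * g .t2 * s1 - g .p4 ^ 2 * g .t2)
      • (1 : A) + (g .p2 * g .t1 + g .u) • (s2 : A) + (-g .p1) • (s3 : A) + (g .p2 * g .L124 -
      g .u * g .L245) • (p3 : A) + (-g .p1 * g .L245) • (v : A) := by
      simp only [Algebra.smul_def, map_add, map_sub, map_neg, map_mul, map_pow, map_ofNat]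
      linear_combination (-1) * h3
    rw [e]
    exact L.add_mem (L.add_mem (L.add_mem (L.add_mem (L.smul_mem _ h_one) (L.smul_mem _ hs2))
      (L.smul_mem _ hs3)) (L.smul_mem _ hp3)) (L.smul_mem _ hv)
  have v_sq : v * v ∈ L := by
    have e : v * v = (g .p1 ^ 2 * g .L123 + g .p1 * g .p2 * g .t2 * g .L136 + g .p1 * g .p4 *
      g .t2 * g .L245 - g .p1 * g .u * g .L125 - g .p1 * g .t2 * s1 + g .p2 ^ 2 * g .t1 * g
      .L123 - g .p2 ^ 2 * g .t2 * g .L125 + g .p2 * g .p4 * g .t1 * g .L124 - g .p2 * g .p4 *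
      g .t2 * g .L126 - g .p2 * g .u * g .t1 * g .L136 + g .p2 * g .u * g .L123 - g .p4 * g .u
      * g .t1 * g .L245 - g .u ^ 2 * g .L136) • (1 : A) + (g .p1 * g .t1 - g .p2 * g .t2) •
      (s2 : A) + (g .p2 * g .t1 + g .u) • (s3 : A) + (g .p1 * g .L124 + g .p2 * g .t2 * g
      .L245 + g .p4 * g .t2) • (p3 : A) + (-g .p1 * g .L126 - g .p2 * g .t1 * g .L245 + g .p2
      * g .L124 - g .p4 * g .t1 - 2 * g .u * g .L245) • (v : A) := by
      simp only [Algebra.smul_def, map_add, map_sub, map_neg, map_mul, map_pow, map_ofNat]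
      linear_combination (-1) * h5
    rw [e]
    exact L.add_mem (L.add_mem (L.add_mem (L.add_mem (L.smul_mem _ h_one) (L.smul_mem _ hs2))
      (L.smul_mem _ hs3)) (L.smul_mem _ hp3)) (L.smul_mem _ hv)
  have p3_s2 : p3 * s2 ∈ L := by
    have e : p3 * s2 = (g .p2 * g .L136 + g .p4 * g .L245 + s1) • (v : A) + (-g .p4) • (s3 :
      A) + (2 * g .p1 * g .L136 - g .p2 * g .L125) • (p3 : A) + (g .p1 ^ 2 * g .L135 + g .p1 *
      g .p4 * g .L125 + g .p2 ^ 2 * g .t1 * g .L135 + 2 * g .p2 * g .p4 * g .t1 * g .L136 + g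
      .p2 * g .u * g .L135 + g .p4 ^ 2 * g .t1 * g .L245 + g .p4 * g .u * g .L136) • (1 : A) +
      (g .L245) • (p3 * p3 : A) := by
      simp only [Algebra.smul_def, map_add, map_sub, map_neg, map_mul, map_pow, map_ofNat]
      linear_combination (-1) * h2
    rw [e]
    exact L.add_mem (L.add_mem (L.add_mem (L.add_mem (L.smul_mem _ hv) (L.smul_mem _ hs3))
      (L.smul_mem _ hp3)) (L.smul_mem _ h_one)) (L.smul_mem _ p3_sq)
  have v_s3 : v * s3 ∈ L := by
    have e : v * s3 = (-g .p1 * g .L123 + g .p2 * g .t2 * g .L136 + g .p4 * g .t2 * g .L245 +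
      g .u * g .L125 + g .t2 * s1) • (p3 : A) + (-g .t1) • (p3 * s2 : A) + (g .p4 * g .t2) •
      (s2 : A) + (-g .p4 * g .t1) • (s3 : A) + (g .p1 * g .p2 * g .t2 * g .L135 + g .p1 * g
      .p4 * g .t2 * g .L136 - g .p2 * g .p4 * g .t1 * g .L123 + g .p2 * g .p4 * g .t2 * g
      .L125 - g .p2 * g .u * g .t1 * g .L135 - g .p4 ^ 2 * g .t1 * g .L124 + g .p4 ^ 2 * g .t2
      * g .L126 - g .p4 * g .u * g .t1 * g .L136 - g .p4 * g .u * g .L123 - g .u ^ 2 * g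
      .L135) • (1 : A) + (-g .L124) • (p3 * p3 : A) + (-g .p2 * g .t1 * g .L136 - g .p4 * g
      .t1 * g .L245 - g .p4 * g .L124 - 2 * g .u * g .L136) • (v : A) + (g .L126) • (v * p3 :
      A) + (-g .L245) • (v * v : A) := by
      simp only [Algebra.smul_def, map_add, map_sub, map_neg, map_mul, map_pow, map_ofNat]
      linear_combination (1) * h6
    rw [e]
    exact L.add_mem (L.add_mem (L.add_mem (L.add_mem (L.add_mem (L.add_mem (L.add_mem
      (L.add_mem (L.smul_mem _ hp3) (L.smul_mem _ p3_s2)) (L.smul_mem _ hs2)) (L.smul_mem _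
      hs3)) (L.smul_mem _ h_one)) (L.smul_mem _ p3_sq)) (L.smul_mem _ hv)) (L.smul_mem _
      v_p3)) (L.smul_mem _ v_sq)
  have s2_sq : s2 * s2 ∈ L := by
    have e : s2 * s2 = (s1) • (s3 : A) + (-g .p1 ^ 2 * g .L135 * g .L245 + g .p1 ^ 2 * g .L136
      ^ 2 - g .p1 * g .p2 * g .L125 * g .L136 + g .p1 * g .p2 * g .L126 * g .L135 - g .p1 * g
      .p4 * g .L125 * g .L245 + g .p1 * g .p4 * g .L126 * g .L136 + g .p2 ^ 2 * g .t1 * g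
      .L135 * g .L245 - g .p2 ^ 2 * g .t1 * g .L136 ^ 2 + g .p2 ^ 2 * g .L123 * g .L136 - g
      .p2 ^ 2 * g .L124 * g .L135 + g .p2 * g .p4 * g .t1 * g .L135 - g .p2 * g .p4 * g .t1 *
      g .L136 * g .L245 + 2 * g .p2 * g .p4 * g .L123 * g .L245 - 2 * g .p2 * g .p4 * g .L124
      * g .L136 + 2 * g .p2 * g .u * g .L135 * g .L245 - 2 * g .p2 * g .u * g .L136 ^ 2 + g
      .p2 * g .L123 * s1 + g .p4 ^ 2 * g .t1 * g .L136 - g .p4 ^ 2 * g .t1 * g .L245 ^ 2 + g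
      .p4 ^ 2 * g .L123 - g .p4 ^ 2 * g .L124 * g .L245 + g .p4 * g .u * g .L135 - g .p4 * g
      .u * g .L136 * g .L245 + g .p4 * g .L124 * s1) • (1 : A) + (-g .p2 * g .L125 - g .p4 * g
      .L126) • (s2 : A) + (-g .p1 * g .L135 + g .p1 * g .L136 * g .L245 - g .p2 * g .L125 * g
      .L245 + g .p2 * g .L126 * g .L136 - g .p4 * g .L125 + g .p4 * g .L126 * g .L245) • (p3 :
      A) + (g .p2 * g .L135 - g .p2 * g .L136 * g .L245 + 2 * g .p4 * g .L136 - 2 * g .p4 * g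
      .L245 ^ 2) • (v : A) + (-g .L136 + g .L245 ^ 2) • (p3 * p3 : A) := by
      simp only [Algebra.smul_def, map_add, map_sub, map_neg, map_mul, map_pow, map_ofNat]
      linear_combination (-1) * h7
    rw [e]
    exact L.add_mem (L.add_mem (L.add_mem (L.add_mem (L.add_mem (L.smul_mem _ hs3) (L.smul_mem
      _ h_one)) (L.smul_mem _ hs2)) (L.smul_mem _ hp3)) (L.smul_mem _ hv)) (L.smul_mem _
      p3_sq)
  have s2_s3 : s2 * s3 ∈ L := by
    have e : s2 * s3 = (g .p1 * g .L125 - g .t1 * s1) • (s2 : A) + (g .p1 ^ 2 * g .L125 * g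
      .L136 - g .p1 ^ 2 * g .L126 * g .L135 - 2 * g .p1 * g .p2 * g .t1 * g .L135 * g .L245 +
      2 * g .p1 * g .p2 * g .t1 * g .L136 ^ 2 - g .p1 * g .p2 * g .L123 * g .L136 + g .p1 * g
      .p2 * g .L124 * g .L135 - g .p1 * g .p4 * g .t1 * g .L135 + g .p1 * g .p4 * g .t1 * g
      .L136 * g .L245 - g .p1 * g .p4 * g .L123 * g .L245 + g .p1 * g .p4 * g .L124 * g .L136
      - 2 * g .p1 * g .u * g .L135 * g .L245 + 2 * g .p1 * g .u * g .L136 ^ 2 - g .p1 * g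
      .L123 * s1 + g .p2 ^ 2 * g .t2 * g .L135 * g .L245 - g .p2 ^ 2 * g .t2 * g .L136 ^ 2 + g
      .p2 * g .p4 * g .t2 * g .L135 - g .p2 * g .p4 * g .t2 * g .L136 * g .L245 + g .p4 ^ 2 *
      g .t2 * g .L136 - g .p4 ^ 2 * g .t2 * g .L245 ^ 2 + g .t2 * s1 ^ 2) • (1 : A) + (2 * g
      .p1 * g .L125 * g .L245 - 2 * g .p1 * g .L126 * g .L136 - g .p2 * g .t1 * g .L135 + g
      .p2 * g .t1 * g .L136 * g .L245 - g .p2 * g .L123 * g .L245 + g .p2 * g .L124 * g .L136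
      - 2 * g .p4 * g .t1 * g .L136 + 2 * g .p4 * g .t1 * g .L245 ^ 2 - g .p4 * g .L123 + g
      .p4 * g .L124 * g .L245 - g .u * g .L135 + g .u * g .L136 * g .L245 - g .L124 * s1) •
      (p3 : A) + (g .L126) • (p3 * s2 : A) + (g .L125 - g .L126 * g .L245) • (p3 * p3 : A) +
      (-g .p1 * g .L135 + g .p1 * g .L136 * g .L245) • (v : A) + (-2 * g .L136 + 2 * g .L245 ^
      2) • (v * p3 : A) := by
      simp only [Algebra.smul_def, map_add, map_sub, map_neg, map_mul, map_pow, map_ofNat]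
      linear_combination (1) * h8
    rw [e]
    exact L.add_mem (L.add_mem (L.add_mem (L.add_mem (L.add_mem (L.add_mem (L.smul_mem _ hs2)
      (L.smul_mem _ h_one)) (L.smul_mem _ hp3)) (L.smul_mem _ p3_s2)) (L.smul_mem _ p3_sq))
      (L.smul_mem _ hv)) (L.smul_mem _ v_p3)
  have p3_s3 : p3 * s3 ∈ N := by
    have e : p3 * s3 = (g .p1 * g .p4 * g .L123 + g .p1 * g .u * g .L135 + g .p2 ^ 2 * g .t2 *
      g .L135 + 2 * g .p2 * g .p4 * g .t2 * g .L136 + g .p4 ^ 2 * g .t2 * g .L245 - g .p4 * g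
      .t2 * s1) • (1 : A) + (1 : T) • (v * s2 : A) + (g .p4 * g .t1) • (s2 : A) + (-g .p2 * g
      .L123 + g .u * g .L136) • (p3 : A) + (g .p1 * g .L136) • (v : A) + (g .L245) • (v * p3 :
      A) := by
      simp only [Algebra.smul_def, map_add, map_sub, map_neg, map_mul, map_pow, map_ofNat, map_one]
      linear_combination (-1) * h4
    rw [e]
    exact N.add_mem (N.add_mem (N.add_mem (N.add_mem (N.add_mem (N.smul_mem _ (hLN h_one))
      (N.smul_mem _ v_s2)) (N.smul_mem _ (hLN hs2))) (N.smul_mem _ (hLN hp3))) (N.smul_mem _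
      (hLN hv))) (N.smul_mem _ (hLN v_p3))
  have s3_sq : s3 * s3 ∈ N := by
    have e : s3 * s3 = (-g .t1) • (s2 * s2 : A) + (g .u * g .L125 + g .t2 * s1) • (s2 : A) +
      (g .p1 ^ 2 * g .L123 * g .L136 - g .p1 ^ 2 * g .L124 * g .L135 - 2 * g .p1 * g .p2 * g
      .t2 * g .L135 * g .L245 + 2 * g .p1 * g .p2 * g .t2 * g .L136 ^ 2 - g .p1 * g .p4 * g
      .t2 * g .L135 + g .p1 * g .p4 * g .t2 * g .L136 * g .L245 + g .p1 * g .p4 * g .L123 * g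
      .L126 - g .p1 * g .p4 * g .L124 * g .L125 + g .p2 ^ 2 * g .t1 * g .L123 * g .L136 - g
      .p2 ^ 2 * g .t1 * g .L124 * g .L135 - g .p2 ^ 2 * g .t2 * g .L125 * g .L136 + g .p2 ^ 2
      * g .t2 * g .L126 * g .L135 + 2 * g .p2 * g .p4 * g .t1 * g .L123 * g .L245 - 2 * g .p2
      * g .p4 * g .t1 * g .L124 * g .L136 - 2 * g .p2 * g .p4 * g .t2 * g .L125 * g .L245 + 2
      * g .p2 * g .p4 * g .t2 * g .L126 * g .L136 + g .p4 ^ 2 * g .t1 * g .L123 - g .p4 ^ 2 *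
      g .t1 * g .L124 * g .L245 - g .p4 ^ 2 * g .t2 * g .L125 + g .p4 ^ 2 * g .t2 * g .L126 *
      g .L245 - g .u ^ 2 * g .L135 * g .L245 + g .u ^ 2 * g .L136 ^ 2 - g .u * g .L123 * s1) •
      (1 : A) + (-g .u * g .L135 + g .u * g .L136 * g .L245 - g .L124 * s1) • (v : A) + (g
      .L126) • (v * s2 : A) + (2 * g .p1 * g .L123 * g .L245 - 2 * g .p1 * g .L124 * g .L136 -
      g .p2 * g .t2 * g .L135 + g .p2 * g .t2 * g .L136 * g .L245 - g .p2 * g .L123 * g .L126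
      + g .p2 * g .L124 * g .L125 - 2 * g .p4 * g .t2 * g .L136 + 2 * g .p4 * g .t2 * g .L245
      ^ 2) • (p3 : A) + (g .L123 - g .L124 * g .L245) • (p3 * p3 : A) + (-g .L136 + g .L245 ^
      2) • (v * v : A) := by
      simp only [Algebra.smul_def, map_add, map_sub, map_neg, map_mul, map_pow, map_ofNat]
      linear_combination (1) * h9
    rw [e]
    exact N.add_mem (N.add_mem (N.add_mem (N.add_mem (N.add_mem (N.add_mem (N.add_mem
      (N.smul_mem _ (hLN s2_sq)) (N.smul_mem _ (hLN hs2))) (N.smul_mem _ (hLN h_one)))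
      (N.smul_mem _ (hLN hv))) (N.smul_mem _ v_s2)) (N.smul_mem _ (hLN hp3))) (N.smul_mem _
      (hLN p3_sq))) (N.smul_mem _ (hLN v_sq))
  have hmul : ∀ z : A, z * 1 ∈ N → z * v ∈ N → z * p3 ∈ N → z * s2 ∈ N → z * s3 ∈ N →
      ∀ {x}, x ∈ L → z * x ∈ N := by
    intro z i1 i2 i3 i4 i5 x hx
    refine (Submodule.span_le (p := N.comap (LinearMap.mulLeft T z))).2 ?_ hx
    rintro _ (rfl | rfl | rfl | rfl | rfl)
    exacts [i1, i2, i3, i4, i5]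
  have hs2L : ∀ {x}, x ∈ L → s2 * x ∈ N := hmul s2 (by simpa using hLN hs2)
    (by rw [mul_comm]; exact v_s2) (by rw [mul_comm]; exact hLN p3_s2) (hLN s2_sq) (hLN s2_s3)
  have hvL : ∀ {x}, x ∈ L → v * x ∈ N := hmul v (by simpa using hLN hv)
    (hLN v_sq) (hLN v_p3) v_s2 (hLN v_s3)
  have hp3L : ∀ {x}, x ∈ L → p3 * x ∈ N := hmul p3 (by simpa using hLN hp3)
    (by rw [mul_comm]; exact hLN v_p3) (hLN p3_sq) (hLN p3_s2) p3_s3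
  have hs3L : ∀ {x}, x ∈ L → s3 * x ∈ N := hmul s3 (by simpa using hLN hs3)
    (by rw [mul_comm]; exact hLN v_s3) (by rw [mul_comm]; exact p3_s3)
    (by rw [mul_comm]; exact hLN s2_s3) s3_sq
  have hstep : ∀ z : A, (∀ {x}, x ∈ L → z * x ∈ N) → z * (v * s2) ∈ N → z * a ∈ N := by
    intro z hz hz'
    refine (Submodule.span_le (p := N.comap (LinearMap.mulLeft T z))).2 ?_ ha
    rintro _ ⟨⟨i, k⟩, rfl⟩
    fin_cases i <;> fin_cases k
    exacts [hz h_one, hz hv, hz hs3, hz hp3, hz hs2, hz']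
  refine ⟨hstep p3 hp3L ?_, hstep v hvL ?_, hstep s2 hs2L ?_, hstep s3 hs3L ?_⟩
  · rw [show p3 * (v * s2) = s2 * (v * p3) by ring]
    exact hs2L v_p3
  · rw [show v * (v * s2) = s2 * (v * v) by ring]
    exact hs2L v_sq
  · rw [show s2 * (v * s2) = v * (s2 * s2) by ring]
    exact hvL s2_sq
  · rw [show s3 * (v * s2) = v * (s2 * s3) by ring]
    exact hvL s2_s3

end Parameters

/-! ### The hypersurface over the parameters -/

section Model

open Polynomial

variable {R : Type*} [CommRing R] (g : ParamVar → R)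

/-- The polynomial `G` with `L246 = 1` and the given values of the parameters, as a cubic in `v`
over the polynomial ring in `p3`. -/
noncomputable def vPoly : R[X][X] :=
  X ^ 3 + C (cubicCoeffTwo (paramTuple (fun b => C (g b)) X 0)) * X ^ 2
    + C (cubicCoeffOne (paramTuple (fun b => C (g b)) X 0)) * X
    + C (G (paramTuple (fun b => C (g b)) X 0))

lemma natDegree_vPoly [Nontrivial R] : (vPoly g).natDegree = 3 := by
  unfold vPoly
  compute_degree!

lemma monic_vPoly [Nontrivial R] : (vPoly g).Monic := by
  unfold vPoly
  monicity!

lemma eval₂_vPoly {S : Type*} [CommRing S] (φ : R[X] →+* S) (r : S) :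
    (vPoly g).eval₂ φ r =
      r ^ 3 + φ (cubicCoeffTwo (paramTuple (fun b => C (g b)) X 0)) * r ^ 2
        + φ (cubicCoeffOne (paramTuple (fun b => C (g b)) X 0)) * r
        + φ (G (paramTuple (fun b => C (g b)) X 0)) := by
  simp only [vPoly, eval₂_add, eval₂_mul, eval₂_C, eval₂_X_pow, eval₂_X]

/-- The coordinate ring `R[p3, v] / (G)` of the hypersurface for the given values of the parameters
in `R`. -/
abbrev Model : Type _ := AdjoinRoot (vPoly g)

/-- The class of `p3`. -/
noncomputable def modelP3 : Model g := algebraMap R[X] (Model g) X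

/-- The class of `v`. -/
noncomputable def modelV : Model g := AdjoinRoot.root (vPoly g)

lemma G_model : G (paramTuple (fun b => algebraMap R (Model g) (g b)) (modelP3 g) (modelV g)) =
    0 := by
  have hz : paramTuple (fun b => algebraMap R (Model g) (g b)) (modelP3 g) 0 =
      (paramTuple (fun b => C (g b)) X 0).map (algebraMap R[X] (Model g)) := by
    rw [paramTuple_map, map_zero]
    rfl
  have h := AdjoinRoot.eval₂_root (vPoly g)
  rw [eval₂_vPoly] at h
  rw [G_paramTuple, hz, cubicCoeffTwo_map, cubicCoeffOne_map, G_map]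
  exact h

/-- The basis `p3ᵏ vᵇ`, `b < 3`. -/
noncomputable def modelBasis [Nontrivial R] : Module.Basis (ℕ × Fin 3) R (Model g) :=
  ((Polynomial.basisMonomials R).smulTower
    (AdjoinRoot.powerBasis' (monic_vPoly g)).basis).reindex
    ((Equiv.refl ℕ).prodCongr (finCongr (natDegree_vPoly g)))

lemma modelBasis_apply [Nontrivial R] (q : ℕ × Fin 3) :
    modelBasis g q = modelP3 g ^ q.1 * modelV g ^ (q.2 : ℕ) := by
  obtain ⟨k, b⟩ := q
  rw [modelBasis, Module.Basis.reindex_apply, Module.Basis.smulTower_apply]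
  rw [PowerBasis.basis_eq_pow]
  simp only [Polynomial.coe_basisMonomials, monomial_one_right_eq_X_pow, Algebra.smul_def,
    map_pow]
  rfl

/-- Modulo the ideal generated by an ideal `𝔪` of `R` modulo which `α = 1` and all other parameters
vanish, the linear equations read `s1 = p3²`, `s2 = p3 v`, `s3 = v²`. -/
lemma linear_equations_mod {B : Type*} [CommRing B] [Algebra R B] {𝔪 : Ideal R}
    (hu : g .u - 1 ∈ 𝔪) (hg : ∀ b, b ≠ .u → g b ∈ 𝔪) {p3 v s1 s2 s3 : B}
    (hF : ∀ i, F ⟨paramTuple (fun b => algebraMap R B (g b)) p3 v, s1, s2, s3⟩ i = 0) :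
    s1 - p3 ^ 2 ∈ 𝔪.map (algebraMap R B) ∧ s2 - p3 * v ∈ 𝔪.map (algebraMap R B) ∧
      s3 - v ^ 2 ∈ 𝔪.map (algebraMap R B) := by
  set q := Ideal.Quotient.mk (𝔪.map (algebraMap R B)) with hq
  have hF' : ∀ i, F (PiTuple.map q
      ⟨paramTuple (fun b => algebraMap R B (g b)) p3 v, s1, s2, s3⟩) i = 0 := fun i => by
    rw [F_map, hF, map_zero]
  obtain ⟨h1, -, h3, -, h5, -⟩ := forall_F_eq_zero hF'
  have h0 : ∀ b, b ≠ .u → q (algebraMap R B (g b)) = 0 := fun b hb =>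
    Ideal.Quotient.eq_zero_iff_mem.2 (Ideal.mem_map_of_mem _ (hg b hb))
  have h1' : q (algebraMap R B (g .u)) = 1 := by
    rw [← map_one q, ← map_one (algebraMap R B)]
    refine Ideal.Quotient.eq.2 ?_
    rw [← map_sub]
    exact Ideal.mem_map_of_mem _ hu
  simp [F1, PiTuple.map, BaseTuple.map, paramTuple, BaseTuple.ofFun, BaseVar.ofParam, h0, h1']
    at h1
  simp [F3, PiTuple.map, BaseTuple.map, paramTuple, BaseTuple.ofFun, BaseVar.ofParam, h0, h1']
    at h3
  simp [F5, PiTuple.map, BaseTuple.map, paramTuple, BaseTuple.ofFun, BaseVar.ofParam, h0, h1']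
    at h5
  refine ⟨Ideal.Quotient.eq.1 ?_, Ideal.Quotient.eq.1 ?_, Ideal.Quotient.eq.1 ?_⟩
  · rw [map_pow]
    linear_combination h1
  · rw [map_mul]
    linear_combination h3
  · rw [map_pow]
    linear_combination h5

/-- The products of powers of `s1` with `1, v, s3, p3, s2, v s2` are linearly independent, since for
`α = 1` and all other parameters zero they form the basis `p3ᵏ vᵇ`. -/
lemma linearIndependent_piSpan [IsDomain R] {𝔪 : Ideal R} (h𝔪 : 𝔪 ≠ ⊤)
    (hu : g .u - 1 ∈ 𝔪) (hg : ∀ b, b ≠ .u → g b ∈ 𝔪) {s1 s2 s3 : Model g}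
    (hF : ∀ i, F ⟨paramTuple (fun b => algebraMap R (Model g) (g b)) (modelP3 g) (modelV g),
      s1, s2, s3⟩ i = 0) :
    LinearIndependent R fun q : ℕ × (Fin 2 × Fin 3) =>
      s1 ^ q.1 * piSpan (modelP3 g) (modelV g) s2 s3 q.2 := by
  refine linearIndependent_of_sub_mem (modelBasis g) h𝔪
    (e := fun q => (2 * q.1 + q.2.1, q.2.2)) ?_ ?_
  · rintro ⟨k, a, b⟩ ⟨k', a', b'⟩ h
    simp only [Prod.mk.injEq] at h ⊢
    obtain ⟨h, h'⟩ := h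
    refine ⟨by omega, Fin.ext (by omega), h'⟩
  · rintro ⟨k, a, b⟩
    obtain ⟨e1, e2, e3⟩ := linear_equations_mod g hu hg hF
    rw [Ideal.smul_top_eq_map, Submodule.restrictScalars_mem, ← Ideal.Quotient.eq,
      modelBasis_apply]
    rw [← Ideal.Quotient.eq] at e1 e2 e3
    simp only [map_mul, map_pow, e1, pow_add, pow_mul]
    rw [mul_assoc]
    congr 1
    fin_cases a <;> fin_cases b <;> simp [piSpan, e2, e3]
    ring

end Model

/-! ### Regularity of a minor -/

section Regularity

variable (m : ℕ)

/-- The polynomial ring in the parameters and the cone coordinates. -/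
abbrev ParamPoly : Type := MvPolynomial (ParamVar ⊕ Fin m) ℂ

/-- The minor `D_{135}` as a polynomial in the parameters. -/
noncomputable def paramMinor : ParamPoly m :=
  D (paramTuple (fun b => MvPolynomial.X (.inl b)) 0 0) 0 2 4

/-- The point with `u = 1` at which all other parameters vanish; there `α = 1`. -/
noncomputable def paramPoint : ParamPoly m →+* ℂ :=
  MvPolynomial.eval (Sum.elim (fun b => match b with | .u => 1 | _ => 0) 0)

lemma paramPoint_paramMinor : paramPoint m (paramMinor m) = 1 := by
  rw [paramMinor, ← D_map, paramTuple_map]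
  simp [paramPoint, D, M, Matrix.det_fin_three, paramTuple, BaseTuple.ofFun, BaseVar.ofParam]

lemma paramMinor_ne_zero : paramMinor m ≠ 0 := fun h => by
  have := paramPoint_paramMinor m
  rw [h, map_zero] at this
  exact zero_ne_one this

/-- The ring of functions on the open subset `D_{135} ≠ 0` of the parameter space. -/
abbrev ParamRing : Type := Localization.Away (paramMinor m)

lemma powers_paramMinor_le :
    Submonoid.powers (paramMinor m) ≤ nonZeroDivisors (ParamPoly m) :=
  powers_le_nonZeroDivisors_of_noZeroDivisors (paramMinor_ne_zero m)

instance : IsDomain (ParamRing m) :=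
  IsLocalization.isDomain_localization (powers_paramMinor_le m)

/-- The values of the parameters in `ParamRing m`. -/
noncomputable def paramVal (b : ParamVar) : ParamRing m :=
  algebraMap (ParamPoly m) (ParamRing m) (MvPolynomial.X (.inl b))

lemma exists_ideal_paramRing : ∃ 𝔪 : Ideal (ParamRing m), 𝔪 ≠ ⊤ ∧ paramVal m .u - 1 ∈ 𝔪 ∧
    ∀ b, b ≠ .u → paramVal m b ∈ 𝔪 := by
  have hunit : IsUnit (paramPoint m (paramMinor m)) := by
    rw [paramPoint_paramMinor]
    exact isUnit_one
  let ε : ParamRing m →+* ℂ := IsLocalization.Away.lift (paramMinor m) hunit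
  have hε : ∀ b, ε (paramVal m b) = paramPoint m (MvPolynomial.X (.inl b)) := fun b =>
    IsLocalization.Away.lift_eq _ _ _
  refine ⟨RingHom.ker ε, RingHom.ker_ne_top ε, ?_, fun b hb => ?_⟩
  · rw [RingHom.mem_ker, map_sub, hε]
    simp [paramPoint]
  · rw [RingHom.mem_ker, hε]
    cases b <;> simp [paramPoint] at hb ⊢

variable (W : Weights)

/-- The inclusion of the parameters into the coordinate ring of the hypersurface. -/
noncomputable def paramToHyp : ParamPoly m →+* HypRing W m :=
  (Ideal.Quotient.mk _).comp
    (MvPolynomial.rename (R := ℂ) (Sum.map ParamVar.toBase id : _ → HypVar m)).toRingHom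

lemma paramToHyp_X (l : ParamVar ⊕ Fin m) : paramToHyp m W (MvPolynomial.X l) =
    Ideal.Quotient.mk _ (MvPolynomial.X (Sum.map ParamVar.toBase id l)) := by
  simp [paramToHyp]

lemma hypTuple_eq_paramTuple : hypTuple W m =
    paramTuple (fun b => paramToHyp m W (MvPolynomial.X (.inl b)))
      (Ideal.Quotient.mk _ (MvPolynomial.X (.inl .p3)))
      (Ideal.Quotient.mk _ (MvPolynomial.X (.inl .v))) := by
  simp only [paramToHyp_X, hypTuple, hypGen, BaseTuple.map, paramTuple, BaseTuple.ofFun,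
    BaseVar.ofParam, map_one]
  rfl

lemma paramToHyp_paramMinor : paramToHyp m W (paramMinor m) = hypMinor W m 0 2 4 := by
  rw [paramMinor, ← D_map, paramTuple_map, ← D_hypTuple, hypTuple_eq_paramTuple]
  exact D_paramTuple _ _ _ _ _

open Polynomial in
/-- The coordinate ring of the hypersurface is spanned by `1, v, v²` over the parameters
and `p3`. -/
lemma hypRing_span (a : HypRing W m) : ∃ P : Fin 3 → (ParamPoly m)[X],
    a = ∑ b, eval₂ (paramToHyp m W) (Ideal.Quotient.mk _ (MvPolynomial.X (.inl .p3))) (P b)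
      * (Ideal.Quotient.mk _ (MvPolynomial.X (.inl .v)) : HypRing W m) ^ (b : ℕ) := by
  let _ : Algebra (ParamPoly m)[X] (HypRing W m) := (eval₂RingHom (paramToHyp m W)
    (Ideal.Quotient.mk _ (MvPolynomial.X (.inl .p3)))).toAlgebra
  have halg : ∀ P : (ParamPoly m)[X], algebraMap (ParamPoly m)[X] (HypRing W m) P =
      eval₂ (paramToHyp m W) (Ideal.Quotient.mk _ (MvPolynomial.X (.inl .p3))) P := fun _ => rfl
  set v : HypRing W m := Ideal.Quotient.mk _ (MvPolynomial.X (.inl .v)) with hv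
  set N := Submodule.span (ParamPoly m)[X] (Set.range fun b : Fin 3 => v ^ (b : ℕ)) with hN
  have hG : G (paramTuple (fun b => algebraMap (ParamPoly m)[X] (HypRing W m)
      (C (MvPolynomial.X (.inl b)))) (algebraMap (ParamPoly m)[X] (HypRing W m) X) v) = 0 := by
    rw [← G_hypTuple W m, hypTuple_eq_paramTuple]
    simp only [halg, eval₂_C, eval₂_X]
    rfl
  have hmem : a ∈ N := by
    obtain ⟨f, rfl⟩ := Ideal.Quotient.mk_surjective a
    induction f using MvPolynomial.induction_on with
    | C c =>
      have h : (Ideal.Quotient.mk _ (MvPolynomial.C c) : HypRing W m) =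
          (C (MvPolynomial.C c) : (ParamPoly m)[X]) • (1 : HypRing W m) := by
        rw [Algebra.smul_def, halg, eval₂_C, mul_one]
        simp [paramToHyp]
      rw [h]
      exact N.smul_mem _ (Submodule.subset_span ⟨0, by simp⟩)
    | add f f' hf hf' =>
      rw [map_add]
      exact N.add_mem hf hf'
    | mul_X f l hf =>
      rw [map_mul, mul_comm]
      have hpar : ∀ l', (Ideal.Quotient.mk _ (MvPolynomial.X (Sum.map ParamVar.toBase id l')) :
          HypRing W m) * Ideal.Quotient.mk _ f ∈ N := by
        intro l'
        rw [← paramToHyp_X, ← eval₂_C (paramToHyp m W), ← halg, ← Algebra.smul_def]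
        exact N.smul_mem _ hf
      rcases l with b | i
      · cases b
        case v => exact v_mul_mem_span _ _ v hG hf
        case p3 =>
          have h : (Ideal.Quotient.mk _ (MvPolynomial.X (.inl .p3)) : HypRing W m) =
              algebraMap (ParamPoly m)[X] (HypRing W m) X := by
            rw [halg, eval₂_X]
          rw [h, ← Algebra.smul_def]
          exact N.smul_mem _ hf
        case p1 => exact hpar (.inl .p1)
        case p2 => exact hpar (.inl .p2)
        case p4 => exact hpar (.inl .p4)
        case u => exact hpar (.inl .u)
        case t1 => exact hpar (.inl .t1)
        case t2 => exact hpar (.inl .t2)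
        case L123 => exact hpar (.inl .L123)
        case L124 => exact hpar (.inl .L124)
        case L125 => exact hpar (.inl .L125)
        case L126 => exact hpar (.inl .L126)
        case L135 => exact hpar (.inl .L135)
        case L136 => exact hpar (.inl .L136)
        case L245 => exact hpar (.inl .L245)
      · exact hpar (.inr i)
  obtain ⟨P, hP⟩ := (Submodule.mem_span_range_iff_exists_fun _).1 hmem
  exact ⟨P, by rw [← hP]; rfl⟩

/-- The coordinate ring of the key variety is spanned by `1, v, s3, p3, s2, v s2` over the
parameters and `s1`. -/
lemma piRing_span (a : PiRing W m) : ∃ P : Fin 2 × Fin 3 → Polynomial (ParamPoly m),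
    a = ∑ b, Polynomial.eval₂ ((coordHom W m).toRingHom.comp (paramToHyp m W))
      (coord W m (.inr 0)) (P b) * piSpan (coord W m (.inl (.inl .p3)))
        (coord W m (.inl (.inl .v))) (coord W m (.inr 1)) (coord W m (.inr 2)) b := by
  let _ : Algebra (Polynomial (ParamPoly m)) (PiRing W m) := (Polynomial.eval₂RingHom
    ((coordHom W m).toRingHom.comp (paramToHyp m W)) (coord W m (.inr 0))).toAlgebra
  have halg : ∀ P : Polynomial (ParamPoly m),
      algebraMap (Polynomial (ParamPoly m)) (PiRing W m) P =
      Polynomial.eval₂ ((coordHom W m).toRingHom.comp (paramToHyp m W))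
        (coord W m (.inr 0)) P := fun _ => rfl
  set p3 := coord W m (.inl (.inl .p3)) with hp3
  set v := coord W m (.inl (.inl .v)) with hv
  set s2 := coord W m (.inr 1) with hs2
  set s3 := coord W m (.inr 2) with hs3
  set N := Submodule.span (Polynomial (ParamPoly m)) (Set.range (piSpan p3 v s2 s3)) with hN
  have hX : ∀ l', (coordHom W m).toRingHom (paramToHyp m W (MvPolynomial.X l')) =
      coord W m (.inl (Sum.map ParamVar.toBase id l')) := by
    intro l'
    rw [paramToHyp_X]
    exact coordHom_coord W m _
  have hF : ∀ i, F ⟨paramTuple (fun b => algebraMap (Polynomial (ParamPoly m)) (PiRing W m)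
      (Polynomial.C (MvPolynomial.X (.inl b)))) p3 v,
      algebraMap (Polynomial (ParamPoly m)) (PiRing W m) Polynomial.X, s2, s3⟩ i = 0 := by
    intro i
    rw [← F_piTuple W m i]
    congr 1
    simp only [halg, Polynomial.eval₂_C, Polynomial.eval₂_X, RingHom.comp_apply, hX]
    simp only [piTuple, piGen, PiTuple.map, BaseTuple.map, paramTuple, BaseTuple.ofFun,
      BaseVar.ofParam, map_one]
    rfl
  have hmem : a ∈ N := by
    obtain ⟨f, rfl⟩ := Ideal.Quotient.mk_surjective a
    induction f using MvPolynomial.induction_on with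
    | C c =>
      have h : (Ideal.Quotient.mk _ (MvPolynomial.C c) : PiRing W m) =
          (Polynomial.C (MvPolynomial.C c) : Polynomial (ParamPoly m)) • (1 : PiRing W m) := by
        rw [Algebra.smul_def, halg, Polynomial.eval₂_C, mul_one]
        have h1 : paramToHyp m W (MvPolynomial.C c) =
            Ideal.Quotient.mk _ (MvPolynomial.C c) := by
          simp [paramToHyp]
        rw [RingHom.comp_apply, h1]
        exact congrArg _ (MvPolynomial.rename_C _ _).symm
      rw [h]
      exact N.smul_mem _ (Submodule.subset_span ⟨(0, 0), rfl⟩)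
    | add f f' hf hf' =>
      rw [map_add]
      exact N.add_mem hf hf'
    | mul_X f l hf =>
      rw [map_mul, mul_comm]
      change coord W m l * _ ∈ N
      obtain ⟨h1, h2, h3, h4⟩ := mul_mem_span_piSpan _ _ p3 v s2 s3 hF hf
      have hpar : ∀ l', coord W m (.inl (Sum.map ParamVar.toBase id l')) *
          Ideal.Quotient.mk _ f ∈ N := by
        intro l'
        rw [← hX, ← RingHom.comp_apply, ← Polynomial.eval₂_C
          ((coordHom W m).toRingHom.comp (paramToHyp m W)) (coord W m (.inr 0)), ← halg,
          ← Algebra.smul_def]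
        exact N.smul_mem _ hf
      rcases l with (b | i) | r
      · cases b
        case v => exact h2
        case p3 => exact h1
        case p1 => exact hpar (.inl .p1)
        case p2 => exact hpar (.inl .p2)
        case p4 => exact hpar (.inl .p4)
        case u => exact hpar (.inl .u)
        case t1 => exact hpar (.inl .t1)
        case t2 => exact hpar (.inl .t2)
        case L123 => exact hpar (.inl .L123)
        case L124 => exact hpar (.inl .L124)
        case L125 => exact hpar (.inl .L125)
        case L126 => exact hpar (.inl .L126)
        case L135 => exact hpar (.inl .L135)
        case L136 => exact hpar (.inl .L136)
        case L245 => exact hpar (.inl .L245)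
      · exact hpar (.inr i)
      · have h5 : coord W m (.inr 0) * Ideal.Quotient.mk _ f ∈ N := by
          rw [← Polynomial.eval₂_X ((coordHom W m).toRingHom.comp (paramToHyp m W))
            (coord W m (.inr 0)), ← halg, ← Algebra.smul_def]
          exact N.smul_mem _ hf
        fin_cases r
        exacts [h5, h3, h4]
  obtain ⟨P, hP⟩ := (Submodule.mem_span_range_iff_exists_fun _).1 hmem
  exact ⟨P, by rw [← hP]; rfl⟩

/-- The homomorphism from the coordinate ring of the hypersurface to `ParamRing m [p3, v] / (G)`. -/
lemma exists_hypToModel : ∃ χ₀ : HypRing W m →+* Model (paramVal m),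
    (∀ s, χ₀ (paramToHyp m W s) = algebraMap (ParamRing m) _ (algebraMap _ (ParamRing m) s)) ∧
    χ₀ (Ideal.Quotient.mk _ (MvPolynomial.X (.inl .p3))) = modelP3 (paramVal m) ∧
    χ₀ (Ideal.Quotient.mk _ (MvPolynomial.X (.inl .v))) = modelV (paramVal m) := by
  let κ : ParamPoly m →+* Model (paramVal m) :=
    (algebraMap (ParamRing m) _).comp (algebraMap _ (ParamRing m))
  let χ' : HypPoly m →+* Model (paramVal m) := MvPolynomial.eval₂Hom (κ.comp MvPolynomial.C)
    (Sum.elim (BaseVar.ofParam (fun b => κ (MvPolynomial.X (.inl b))) (modelP3 _) (modelV _))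
      fun i => κ (MvPolynomial.X (.inr i)))
  have hker : ∀ a ∈ (hypIdeal W m).toIdeal, χ' a = 0 := by
    have : (hypIdeal W m).toIdeal ≤ RingHom.ker χ' := by
      refine Ideal.span_le.2 ?_
      rintro _ rfl
      change χ' (G (hypGen m)) = 0
      have hx : (hypGen m).map χ' = paramTuple (fun b => algebraMap _ (Model (paramVal m))
          (paramVal m b)) (modelP3 _) (modelV _) := by
        simp only [hypGen, BaseTuple.map, paramTuple, BaseTuple.ofFun, χ',
          MvPolynomial.eval₂Hom_X', Sum.elim_inl, map_one]
        rfl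
      rw [← G_map, hx, G_model]
    exact this
  refine ⟨Ideal.Quotient.lift _ χ' hker, fun s => ?_, ?_, ?_⟩
  · have : χ'.comp (MvPolynomial.rename (R := ℂ)
        (Sum.map ParamVar.toBase id : _ → HypVar m)).toRingHom = κ := by
      refine MvPolynomial.ringHom_ext (fun c => ?_) fun l => ?_
      · simp [χ']
      · rcases l with b | i
        · cases b <;> simp [χ', ParamVar.toBase, BaseVar.ofParam]
        · simp [χ']
    exact congrArg (fun h : ParamPoly m →+* Model (paramVal m) => h s) this
  · rw [Ideal.Quotient.lift_mk]
    simp [χ', BaseVar.ofParam]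
  · rw [Ideal.Quotient.lift_mk]
    simp [χ', BaseVar.ofParam]

/-- On both the hypersurface and the key variety, the minor `D_{135}` is a nonzerodivisor: both
coordinate rings embed into `ParamRing m [p3, v] / (G)`, where this minor is invertible. -/
lemma minor_regular :
    (∀ a : HypRing W m, hypMinor W m 0 2 4 * a = 0 → a = 0) ∧
    (∀ a : PiRing W m, minor W m 0 2 4 * a = 0 → a = 0) := by
  obtain ⟨𝔪, h𝔪, hu, hg⟩ := exists_ideal_paramRing m
  obtain ⟨χ₀, hχ₀, hp3, hv⟩ := exists_hypToModel m W
  have hunit : IsUnit (χ₀ (hypMinor W m 0 2 4)) := by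
    rw [← paramToHyp_paramMinor, hχ₀]
    exact (IsLocalization.Away.algebraMap_isUnit (paramMinor m)).map _
  obtain ⟨χ, hχ⟩ := exists_extension W m χ₀ hunit
  have hinj : Function.Injective (algebraMap (ParamPoly m) (ParamRing m)) :=
    IsLocalization.injective _ (powers_paramMinor_le m)
  have h0 : Function.Injective χ₀ := by
    refine injective_of_span_of_linearIndependent _ _ _ (hypRing_span m W) χ₀ _ hinj hχ₀ ?_
    have : (fun q : ℕ × Fin 3 => χ₀ (Ideal.Quotient.mk _ (MvPolynomial.X (.inl .p3))) ^ q.1 *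
        χ₀ ((Ideal.Quotient.mk _ (MvPolynomial.X (.inl .v)) : HypRing W m) ^ (q.2 : ℕ))) =
        modelBasis (paramVal m) := by
      funext q
      rw [map_pow, hp3, hv, modelBasis_apply]
    rw [this]
    exact (modelBasis (paramVal m)).linearIndependent
  have hF : ∀ i, F ⟨paramTuple (fun b => algebraMap (ParamRing m) (Model (paramVal m))
      (paramVal m b)) (modelP3 _) (modelV _), χ (coord W m (.inr 0)), χ (coord W m (.inr 1)),
      χ (coord W m (.inr 2))⟩ i = 0 := by
    intro i
    rw [← map_zero χ, ← F_piTuple W m i, ← F_map]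
    congr 1
    have h : (piTuple W m).toBaseTuple.map χ = paramTuple (fun b => algebraMap (ParamRing m)
        (Model (paramVal m)) (paramVal m b)) (modelP3 _) (modelV _) := by
      rw [← hypTuple_map_coordHom]
      have h' : ((hypTuple W m).map (coordHom W m).toRingHom).map χ = (hypTuple W m).map χ₀ := by
        simp only [BaseTuple.map, GradedRingHom.coe_toRingHom, hχ]
      rw [h', hypTuple_eq_paramTuple, paramTuple_map, hp3, hv]
      simp only [hχ₀]
      rfl
    rw [PiTuple.map, h]
    rfl
  have h1 : Function.Injective χ := by
    refine injective_of_span_of_linearIndependent _ _ _ (piRing_span m W) χ _ hinj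
      (fun s => (hχ _).trans (hχ₀ s)) ?_
    have hb : ∀ b, χ (piSpan (coord W m (.inl (.inl .p3))) (coord W m (.inl (.inl .v)))
        (coord W m (.inr 1)) (coord W m (.inr 2)) b) = piSpan (modelP3 _) (modelV _)
        (χ (coord W m (.inr 1))) (χ (coord W m (.inr 2))) b := by
      have e1 : χ (coord W m (.inl (.inl .p3))) = modelP3 _ := by
        rw [← coordHom_coord, hχ, hp3]
      have e2 : χ (coord W m (.inl (.inl .v))) = modelV _ := by
        rw [← coordHom_coord, hχ, hv]
      rintro ⟨i, k⟩
      fin_cases i <;> fin_cases k <;> simp [piSpan, e1, e2]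
    simp only [hb]
    exact linearIndependent_piSpan (paramVal m) h𝔪 hu hg hF
  refine ⟨fun a ha => ?_, fun a ha => ?_⟩
  · refine h0 ?_
    rw [map_zero]
    have h := congrArg χ₀ ha
    rw [map_mul, map_zero] at h
    exact (hunit.mul_right_eq_zero).1 h
  · refine h1 ?_
    rw [map_zero]
    have h := congrArg χ ha
    rw [map_mul, map_zero, ← coordHom_hypMinor, hχ] at h
    exact (hunit.mul_right_eq_zero).1 h

lemma isBirationalMap_piProjection : IsBirationalMap (piProjection W m) := by
  obtain ⟨n, hn, hmem⟩ := exists_hypMinor_mem W m 0 2 4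
  obtain ⟨h0, h1⟩ := minor_regular m W
  refine isBirationalMap_projection (coordHom W m) hmem hn (bijective_awayMap_hypMinor W m 0 2 4)
    h0 ?_
  rw [coordHom_hypMinor]
  exact h1

lemma minorLocus_ne_univ [Nonempty (PiP W m)] : minorLocus W m ≠ Set.univ := by
  intro h
  obtain ⟨x, hx⟩ := (dense_basicOpen (𝒜 := piGrading W m) (minor_regular m W).2).nonempty
  have hx' : x ∈ minorLocus W m := h ▸ Set.mem_univ x
  exact hx' _ ⟨0, 2, 4, by decide, by decide, rfl⟩ hx

end Regularity

/-! ### The `s1`-point and the domain of the projection -/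

section Center

variable {Q : Type*} [CommRing Q]

/-- When all coordinates other than `s1, s2, s3` vanish, the equations reduce to
`s2² = s1 s3`, `s2 s3 = 0` and `s3² = 0`. -/
lemma F_center (s1 s2 s3 : Q) : F ⟨⟨0, 0, 0, 0, 0, 0, 0, 0, 0, 0, 0, 0, 0, 0, 0, 1⟩, s1, s2, s3⟩ =
    ![0, 0, 0, 0, 0, 0, -s2 ^ 2 + s1 * s3, s2 * s3, s3 ^ 2] := by
  ext i
  fin_cases i <;> simp [F, F1, F2, F3, F4, F5, F6, F7, F8, F9]

variable (W : Weights) (m : ℕ)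

lemma map_piGen_eq (χ : PiPoly m →+* Q) (h : ∀ i : HypVar m, χ (MvPolynomial.X (.inl i)) = 0) :
    (piGen m).map χ = ⟨⟨0, 0, 0, 0, 0, 0, 0, 0, 0, 0, 0, 0, 0, 0, 0, 1⟩,
      χ (MvPolynomial.X (.inr 0)), χ (MvPolynomial.X (.inr 1)), χ (MvPolynomial.X (.inr 2))⟩ := by
  simp only [piGen, PiTuple.map, BaseTuple.map, BaseTuple.ofFun, h, map_one]

lemma center_equations {χ : PiPoly m →+* Q} (hI : ∀ f ∈ (piIdeal W m).toIdeal, χ f = 0)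
    (h : ∀ i : HypVar m, χ (MvPolynomial.X (.inl i)) = 0) :
    χ (MvPolynomial.X (.inr 1)) ^ 2 = χ (MvPolynomial.X (.inr 0)) * χ (MvPolynomial.X (.inr 2)) ∧
      χ (MvPolynomial.X (.inr 1)) * χ (MvPolynomial.X (.inr 2)) = 0 ∧
      χ (MvPolynomial.X (.inr 2)) ^ 2 = 0 := by
  have hF : ∀ i, F ((piGen m).map χ) i = 0 := fun i => by
    rw [F_map]
    exact hI _ (Ideal.subset_span ⟨i, rfl⟩)
  rw [map_piGen_eq m χ h, F_center] at hF
  have h7 : -χ (MvPolynomial.X (.inr 1)) ^ 2 +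
    χ (MvPolynomial.X (.inr 0)) * χ (MvPolynomial.X (.inr 2)) = 0 := hF 6
  exact ⟨by linear_combination -h7, hF 7, hF 8⟩

/-- Evaluation at the point whose coordinates other than `s1, s2, s3` vanish. -/
noncomputable def centerEval [Algebra ℂ Q] (s1 s2 s3 : Q) : PiPoly m →+* Q :=
  (MvPolynomial.aeval (R := ℂ) (Sum.elim (fun _ => 0) ![s1, s2, s3]) : PiPoly m →ₐ[ℂ] Q).toRingHom

lemma centerEval_inl [Algebra ℂ Q] (s1 s2 s3 : Q) (i : HypVar m) :
    centerEval m s1 s2 s3 (MvPolynomial.X (.inl i)) = 0 := by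
  simp [centerEval]

lemma centerEval_inr [Algebra ℂ Q] (s1 s2 s3 : Q) (i : Fin 3) :
    centerEval m s1 s2 s3 (MvPolynomial.X (.inr i)) = ![s1, s2, s3] i := by
  simp [centerEval]

lemma piIdeal_le_ker_centerEval [Algebra ℂ Q] {s1 s2 s3 : Q} (h7 : s2 ^ 2 = s1 * s3)
    (h8 : s2 * s3 = 0) (h9 : s3 ^ 2 = 0) :
    (piIdeal W m).toIdeal ≤ RingHom.ker (centerEval m s1 s2 s3) := by
  refine Ideal.span_le.2 ?_
  rintro _ ⟨l, rfl⟩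
  change centerEval m s1 s2 s3 (F (piGen m) l) = 0
  rw [← F_map, map_piGen_eq m _ (centerEval_inl m s1 s2 s3), centerEval_inr, centerEval_inr,
    centerEval_inr]
  change F ⟨_, s1, s2, s3⟩ l = 0
  rw [F_center, h7, h8, h9]
  fin_cases l <;> simp

/-- On the chart `s1 = 1` of the intersection with `ℙ(s1, s2, s3)` one has `s3 = s2²` and
`s2³ = 0`, while `s2 ≠ 0`, as the tangent vector `s2 = ε` shows. -/
lemma not_isReduced_centerChart : ¬ _root_.IsReduced (CenterChart W m) := by
  intro hred
  set K : Ideal (PiPoly m) := (piIdeal W m).toIdeal ⊔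
    Ideal.span (Set.range fun i : HypVar m => (MvPolynomial.X (.inl i) : PiPoly m)) ⊔
    Ideal.span {MvPolynomial.X (.inr 0) - 1} with hK
  have hX : ∀ i : HypVar m, Ideal.Quotient.mk K (MvPolynomial.X (.inl i)) = 0 := fun i =>
    Ideal.Quotient.eq_zero_iff_mem.2
      (Ideal.mem_sup_left (Ideal.mem_sup_right (Ideal.subset_span ⟨i, rfl⟩)))
  have h1 : Ideal.Quotient.mk K (MvPolynomial.X (.inr 0)) = 1 := by
    rw [← map_one (Ideal.Quotient.mk K)]
    exact Ideal.Quotient.eq.2 (Ideal.mem_sup_right (Ideal.subset_span rfl))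
  obtain ⟨h7, h8, -⟩ := center_equations W m (χ := Ideal.Quotient.mk K) (fun f hf =>
    Ideal.Quotient.eq_zero_iff_mem.2 (Ideal.mem_sup_left (Ideal.mem_sup_left hf))) hX
  rw [h1, one_mul] at h7
  have hnil : IsNilpotent (Ideal.Quotient.mk K (MvPolynomial.X (.inr 1))) := by
    refine ⟨3, ?_⟩
    rw [pow_succ, h7, mul_comm, h8]
  have h0 := Ideal.Quotient.eq_zero_iff_mem.1 hnil.eq_zero
  have hle : K ≤ RingHom.ker (centerEval m (1 : DualNumber ℂ) DualNumber.eps 0) := by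
    refine sup_le (sup_le ?_ ?_) ?_
    · refine piIdeal_le_ker_centerEval W m ?_ ?_ ?_
      · rw [pow_two, DualNumber.eps_mul_eps, mul_zero]
      · rw [mul_zero]
      · rw [zero_pow two_ne_zero]
    · refine Ideal.span_le.2 ?_
      rintro _ ⟨i, rfl⟩
      exact centerEval_inl m _ _ _ i
    · refine Ideal.span_le.2 ?_
      rintro _ rfl
      change centerEval m _ _ _ _ = 0
      rw [map_sub, map_one, centerEval_inr]
      exact sub_self _
  have h := hle h0
  rw [RingHom.mem_ker, centerEval_inr] at h
  have h' := congrArg TrivSqZeroExt.snd h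
  simp at h'

/-- A weighted homogeneous polynomial of positive degree has no constant term. -/
lemma mem_span_X_of_mem {σ : Type*} {w : σ → ℕ} {n : ℕ} (hn : 0 < n) {p : MvPolynomial σ ℂ}
    (hp : p ∈ MvPolynomial.weightedHomogeneousSubmodule ℂ w n) :
    p ∈ Ideal.span (Set.range (MvPolynomial.X (R := ℂ) (σ := σ))) := by
  rw [← Set.image_univ, MvPolynomial.mem_ideal_span_X_image]
  intro d hd
  by_contra! H
  have hd0 : d = 0 := Finsupp.ext fun i => H i (Set.mem_univ i)
  have := hp (MvPolynomial.mem_support_iff.1 hd)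
  rw [hd0, map_zero] at this
  omega

/-- Modulo the other indeterminates, a weighted homogeneous polynomial is a multiple of a power of
a given indeterminate of positive weight. -/
lemma exists_sub_mem_span_X {σ : Type*} {w : σ → ℕ} {n : ℕ} {i₀ : σ} (h₀ : 0 < w i₀)
    {p : MvPolynomial σ ℂ} (hp : p ∈ MvPolynomial.weightedHomogeneousSubmodule ℂ w n) :
    ∃ (c : ℂ) (k : ℕ), p - MvPolynomial.C c * MvPolynomial.X i₀ ^ k ∈
      Ideal.span (MvPolynomial.X (R := ℂ) '' {i | i ≠ i₀}) := by
  classical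
  have hsingle : ∀ d : σ →₀ ℕ, (∀ i ∈ {i | i ≠ i₀}, d i = 0) → d = Finsupp.single i₀ (d i₀) := by
    intro d hd
    ext i
    by_cases hi : i = i₀
    · subst hi; simp
    · rw [hd i hi, Finsupp.single_eq_of_ne hi]
  by_cases H : ∃ k, Finsupp.single i₀ k ∈ p.support
  · obtain ⟨k, hk⟩ := H
    refine ⟨p.coeff (Finsupp.single i₀ k), k, ?_⟩
    rw [MvPolynomial.C_mul_X_pow_eq_monomial, MvPolynomial.mem_ideal_span_X_image]
    intro e he
    rw [MvPolynomial.mem_support_iff, MvPolynomial.coeff_sub, MvPolynomial.coeff_monomial] at he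
    by_contra! he0
    -- the degree determines the exponent of `X i₀`
    have hne : Finsupp.single i₀ k ≠ e := by
      rintro rfl
      simp at he
    rw [if_neg hne, sub_zero] at he
    have h1 := hp he
    have h2 := hp (MvPolynomial.mem_support_iff.1 hk)
    rw [hsingle e he0] at h1
    rw [← h2, Finsupp.weight_single, Finsupp.weight_single, smul_eq_mul, smul_eq_mul] at h1
    refine hne ?_
    rw [hsingle e he0, Nat.eq_of_mul_eq_mul_right h₀ h1]
  · refine ⟨0, 0, ?_⟩
    rw [map_zero, zero_mul, sub_zero, MvPolynomial.mem_ideal_span_X_image]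
    intro e he
    by_contra! he0
    exact H ⟨e i₀, hsingle e he0 ▸ he⟩

variable {W m}

lemma notMem_basicOpen_iff {x : PiP W m} {f : PiRing W m} :
    x ∉ Proj.basicOpen (piGrading W m) f ↔ f ∈ x.asHomogeneousIdeal := by
  rw [Proj.mem_basicOpen, not_not]

lemma coord_mem (i : PiVar m) : coord W m i ∈ piGrading W m (W.pi m i) :=
  mk_mem_quotGrading _ _ (X_mem rfl)

lemma exists_coord_notMem (x : PiP W m) : ∃ i, coord W m i ∉ x.asHomogeneousIdeal := by
  by_contra! H
  refine x.not_irrelevant_le ((HomogeneousIdeal.toIdeal_irrelevant_le _).2 ?_)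
  rintro n hn _ ⟨p, hp, rfl⟩
  have hle : Ideal.span (Set.range (MvPolynomial.X (R := ℂ) (σ := PiVar m))) ≤
      x.asHomogeneousIdeal.toIdeal.comap (Ideal.Quotient.mk (piIdeal W m).toIdeal) := by
    refine Ideal.span_le.2 ?_
    rintro _ ⟨i, rfl⟩
    exact H i
  exact hle (mem_span_X_of_mem hn hp)

/-- By the equations `s3² = 0` and `s2² = s1 s3`, only `s1` can be nonzero at a point of the
intersection with `ℙ(s1, s2, s3)`. -/
lemma isS1Point_of_mem_center {x : PiP W m} (hx : x ∈ center W m) : IsS1Point W m x := by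
  have hx' : ∀ i, coord W m (.inl i) ∈ x.asHomogeneousIdeal := fun i =>
    notMem_basicOpen_iff.1 (hx _ ⟨i, rfl⟩)
  have hp := x.isPrime
  obtain ⟨h7, -, h9⟩ := center_equations W m
    (χ := (Ideal.Quotient.mk x.asHomogeneousIdeal.toIdeal).comp
      (Ideal.Quotient.mk (piIdeal W m).toIdeal))
    (fun f hf => by rw [RingHom.comp_apply, Ideal.Quotient.eq_zero_iff_mem.2 hf, map_zero])
    (fun i => Ideal.Quotient.eq_zero_iff_mem.2 (hx' i))
  have h3 := pow_eq_zero_iff two_ne_zero |>.1 h9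
  rw [h3, mul_zero] at h7
  have h2 := pow_eq_zero_iff two_ne_zero |>.1 h7
  have h2' : coord W m (.inr 1) ∈ x.asHomogeneousIdeal := Ideal.Quotient.eq_zero_iff_mem.1 h2
  have h3' : coord W m (.inr 2) ∈ x.asHomogeneousIdeal := Ideal.Quotient.eq_zero_iff_mem.1 h3
  have hall : ∀ i, i ≠ .inr 0 → coord W m i ∈ x.asHomogeneousIdeal := by
    rintro (i | i) hi
    · exact hx' i
    · fin_cases i
      · exact absurd rfl hi
      · exact h2'
      · exact h3'
  refine ⟨fun i hi => notMem_basicOpen_iff.2 (hall i hi), ?_⟩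
  obtain ⟨i, hi⟩ := exists_coord_notMem x
  by_contra h1
  rw [notMem_basicOpen_iff] at h1
  by_cases hi0 : i = .inr 0
  · exact hi (hi0 ▸ h1)
  · exact hi (hall i hi0)

lemma mem_center_of_isS1Point {x : PiP W m} (hx : IsS1Point W m x) : x ∈ center W m := by
  rintro _ ⟨i, rfl⟩
  exact hx.1 _ Sum.inl_ne_inr

lemma le_of_isS1Point {x y : PiP W m} (hx : IsS1Point W m x) (hy : IsS1Point W m y) :
    x.asHomogeneousIdeal ≤ y.asHomogeneousIdeal := by
  have hle : ∀ {z : PiP W m}, IsS1Point W m z →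
      Ideal.span (MvPolynomial.X (R := ℂ) (σ := PiVar m) '' {i | i ≠ .inr 0}) ≤
        z.asHomogeneousIdeal.toIdeal.comap (Ideal.Quotient.mk (piIdeal W m).toIdeal) := by
    intro z hz
    refine Ideal.span_le.2 ?_
    rintro _ ⟨i, hi, rfl⟩
    exact notMem_basicOpen_iff.1 (hz.1 i hi)
  -- a homogeneous element of the ideal of `x` lies in the ideal of the coordinates other than `s1`
  have hhom : ∀ n, ∀ f ∈ piGrading W m n, f ∈ x.asHomogeneousIdeal →
      f ∈ y.asHomogeneousIdeal := by
    rintro n _ ⟨p, hp, rfl⟩ hpx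
    obtain ⟨c, k, hck⟩ := exists_sub_mem_span_X (i₀ := (.inr 0 : PiVar m)) W.s1_pos hp
    have hc : c = 0 := by
      by_contra hc
      have h1 : Ideal.Quotient.mk (piIdeal W m).toIdeal
          (MvPolynomial.C c * MvPolynomial.X (.inr 0) ^ k) ∈ x.asHomogeneousIdeal := by
        have := x.asHomogeneousIdeal.toIdeal.sub_mem hpx (hle hx hck)
        rwa [AlgHom.toLinearMap_apply, Ideal.Quotient.mkₐ_eq_mk, ← map_sub, sub_sub_cancel] at this
      have hu : IsUnit (Ideal.Quotient.mk (piIdeal W m).toIdeal (MvPolynomial.C c)) :=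
        ((isUnit_iff_ne_zero.2 hc).map MvPolynomial.C).map _
      rw [map_mul, map_pow] at h1
      have h2 := (Ideal.unit_mul_mem_iff_mem _ hu).1 h1
      exact hx.2 (x.isPrime.mem_of_pow_mem _ h2)
    rw [hc, map_zero, zero_mul, sub_zero] at hck
    exact hle hy hck
  classical
  intro f hf
  rw [← DirectSum.sum_support_decompose (piGrading W m) f]
  exact y.asHomogeneousIdeal.toIdeal.sum_mem fun n _ => hhom n _ (SetLike.coe_mem _)
    (x.asHomogeneousIdeal.isHomogeneous n hf)

variable (W m)

/-- The `s1`-point lies on the key variety: there `s2² = s1 s3`, `s2 s3 = 0` and `s3² = 0`. -/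
lemma exists_isS1Point : ∃ x : PiP W m, IsS1Point W m x := by
  let χ : PiRing W m →+* Polynomial ℂ := Ideal.Quotient.lift _
    (centerEval m (Polynomial.X : Polynomial ℂ) 0 0)
    (piIdeal_le_ker_centerEval W m (by simp) (by simp) (by simp))
  have hχ : ∀ i : Fin 3, χ (coord W m (.inr i)) = ![Polynomial.X, 0, 0] i := fun i =>
    centerEval_inr m _ _ _ i
  have hker : ∀ i, i ≠ .inr 0 → coord W m i ∈ RingHom.ker χ := by
    rintro (i | i) hi
    · exact centerEval_inl m _ _ _ i
    · rw [RingHom.mem_ker, hχ]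
      fin_cases i
      · exact absurd rfl hi
      · rfl
      · rfl
  have h1 : coord W m (.inr 0) ∉ RingHom.ker χ := by
    rw [RingHom.mem_ker, hχ]
    exact Polynomial.X_ne_zero
  have hle : ((RingHom.ker χ).homogeneousCore (piGrading W m)).toIdeal ≤ RingHom.ker χ :=
    Ideal.toIdeal_homogeneousCore_le _ _
  let x : PiP W m := ⟨(RingHom.ker χ).homogeneousCore (piGrading W m),
    (RingHom.ker_isPrime χ).homogeneousCore, fun h => h1 (hle (h
      (HomogeneousIdeal.mem_irrelevant_of_mem _ W.s1_pos (coord_mem (.inr 0)))))⟩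
  refine ⟨x, fun i hi => notMem_basicOpen_iff.2 ?_, fun h => h1 (hle h)⟩
  exact Ideal.mem_homogeneousCore_of_homogeneous_of_mem ⟨_, coord_mem i⟩ (hker i hi)

lemma exists_center_eq_singleton : ∃ x : PiP W m, IsS1Point W m x ∧ center W m = {x} := by
  obtain ⟨x, hx⟩ := exists_isS1Point W m
  refine ⟨x, hx, Set.eq_singleton_iff_unique_mem.2 ⟨mem_center_of_isS1Point hx, fun y hy => ?_⟩⟩
  have hy' := isS1Point_of_mem_center hy
  exact ProjectiveSpectrum.ext (le_antisymm (le_of_isS1Point hy' hx) (le_of_isS1Point hx hy'))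

instance : Nonempty (PiP W m) := ⟨(exists_isS1Point W m).choose⟩

lemma hyp_pos (i : HypVar m) : 0 < W.hyp m i := by
  rcases i with b | j
  · exact W.get_pos b
  · exact Nat.one_pos

/-- The projection is defined where some coordinate other than `s1, s2, s3` does not vanish, as
these coordinates generate the irrelevant ideal of the coordinate ring of the hypersurface. -/
lemma piDomain_eq : (piDomain W m : Set (PiP W m)) = (center W m)ᶜ := by
  ext x
  rw [Set.mem_compl_iff, SetLike.mem_coe, piDomain, projDomain, TopologicalSpace.Opens.mem_iSup]
  constructor
  · rintro ⟨⟨⟨n, hn⟩, _, p, hp, rfl⟩, hf⟩ hx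
    refine hf ?_
    have hle : Ideal.span (Set.range (MvPolynomial.X (R := ℂ) (σ := HypVar m))) ≤
        x.asHomogeneousIdeal.toIdeal.comap ((coordHom W m).toRingHom.comp
          (Ideal.Quotient.mk (hypIdeal W m).toIdeal)) := by
      refine Ideal.span_le.2 ?_
      rintro _ ⟨i, rfl⟩
      change coordHom W m (Ideal.Quotient.mk _ (MvPolynomial.X i)) ∈ x.asHomogeneousIdeal
      rw [coordHom_coord]
      exact notMem_basicOpen_iff.1 (hx _ ⟨i, rfl⟩)
    exact hle (mem_span_X_of_mem hn hp)
  · intro hx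
    simp only [center, vanishing, Set.mem_ofPred_eq, Set.forall_mem_range, not_forall, not_not] at hx
    obtain ⟨i, hi⟩ := hx
    refine ⟨⟨⟨W.hyp m i, hyp_pos W m i⟩, Ideal.Quotient.mk _ (MvPolynomial.X i),
      mk_mem_quotGrading _ _ (X_mem rfl)⟩, ?_⟩
    change x ∈ Proj.basicOpen _ (coordHom W m _)
    rwa [coordHom_coord]

end Center

end KeyVariety

theorem proposition8p2 (W : KeyVariety.Weights) (m : ℕ) (hm : m ≤ 1) :
    -- set-theoretically, the intersection with `ℙ(s1, s2, s3)` is the `s1`-point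
    (∃ x : KeyVariety.PiP W m, KeyVariety.IsS1Point W m x ∧ KeyVariety.center W m = {x}) ∧
    -- it is nonreduced on the local index cover
    ¬ _root_.IsReduced (KeyVariety.CenterChart W m) ∧
    -- the projection is defined exactly off this intersection and is birational
    (KeyVariety.piDomain W m : Set (KeyVariety.PiP W m)) = (KeyVariety.center W m)ᶜ ∧
    KeyVariety.IsBirationalMap (KeyVariety.piProjection W m) ∧
    -- the exceptional locus lies in the common zero set of the minors
    KeyVariety.exceptionalLocus (KeyVariety.piProjection W m) ⊆ KeyVariety.minorLocus W m ∧
    IsClosed (KeyVariety.minorLocus W m) ∧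
    KeyVariety.minorLocus W m ≠ Set.univ :=
  ⟨KeyVariety.exists_center_eq_singleton W m, KeyVariety.not_isReduced_centerChart W m,
    KeyVariety.piDomain_eq W m, KeyVariety.isBirationalMap_piProjection m W,
    KeyVariety.exceptionalLocus_subset_minorLocus W m, KeyVariety.isClosed_minorLocus W m,
    KeyVariety.minorLocus_ne_univ m W⟩
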